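/- Let $k\ge 2$, and let $H$ be a finite $k$-uniform hypergraph ($k$-graph) with $e_H\ge 1$ edges. Let $G^{(k)}_{n,p}$ be the random $k$-graph on $n$ labelled vertices in which each of the $\binom nk$ possible edges is included independently with probability $p$. For a $k$-graph $J$, let $X_J=X_J(n,p)$ be the number of copies of $J$ in $G^{(k)}_{n,p}$, that is, the number of (not necessarily induced) subgraphs of $G^{(k)}_{n,p}$ that are isomorphic to $J$. Define $$\Phi_H=\Phi_H(n,p)=\min\{\mathbb E X_J : J\subseteq H,\ e_J\ge 1\},$$ where $J$ ranges over all subgraphs of $H$ with at least one edge. Then there are positive constants $c$, $C$, $D$ and $n_0$, all depending only on $H$, such that for all $n\ge n_0$, all $p\in[0,1)$ and all $\varepsilon\in[0,1]$ satisfying $\varepsilon^2\Phi_H\ge \mathbf 1\{\varepsilon<1\}D$ (that is, $\varepsilon^2\Phi_H\ge D$ if $\varepsilon<1$, and no condition if $\varepsilon=1$) we have $$\exp\{-(1-p)^{-5}C\varepsilon^2\Phi_H\}\ \le\ \mathbb P\bigl(X_H\le(1-\varepsilon)\,\mathbb E X_H\bigr)\ \le\ \exp\{-c\,\varepsilon^2\Phi_H\}.$$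 -/

import Mathlib

open MeasureTheory ProbabilityTheory

namespace LowerTail

universe u v

/-- `H` is a (finite) `k`-graph: a hypergraph with finitely many vertices, all of whose edges have
exactly `k` vertices. -/
def IsKGraph {α : Type u} (k : ℕ) (H : Hypergraph α) : Prop :=
  H.vertexSet.Finite ∧ ∀ e ∈ H.edgeSet, e.ncard = k

/-- `J` is a (not necessarily induced, not necessarily spanning) subgraph of `H`. -/
def IsSubgraph {α : Type u} (J H : Hypergraph α) : Prop :=
  J.vertexSet ⊆ H.vertexSet ∧ J.edgeSet ⊆ H.edgeSet

/-- `H` and `J` are isomorphic: some bijection between the vertex sets maps edges to edges and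
non-edges to non-edges. -/
def IsIsomorphic {α : Type u} {β : Type v} (H : Hypergraph α) (J : Hypergraph β) : Prop :=
  ∃ φ : H.vertexSet ≃ J.vertexSet, ∀ e : Set H.vertexSet,
    Subtype.val '' e ∈ H.edgeSet ↔ Subtype.val '' (φ '' e) ∈ J.edgeSet

/-- The number of copies of `H` in `G`, i.e. of subgraphs of `G` that are isomorphic to `H`. -/
noncomputable def copyCount {α : Type u} {β : Type v} (H : Hypergraph α) (G : Hypergraph β) : ℕ :=
  {J : Hypergraph β | IsSubgraph J G ∧ IsIsomorphic H J}.ncard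

/-- The hypergraph on the vertex set `Fin n` with edge set `S`. -/
def ofEdgeSet (n : ℕ) (S : Set (Set (Fin n))) : Hypergraph (Fin n) where
  vertexSet := Set.univ
  edgeSet := S
  subset_vertexSet_of_mem_edgeSet' := fun e _ => Set.subset_univ e

/-- The law of the edge set of the binomial random `k`-graph on `n` vertices: each of the
`k`-element subsets of `Fin n` is included independently with probability `p`. -/
noncomputable def randomEdges (k n : ℕ) (p : unitInterval) : Measure (Set (Set (Fin n))) :=
  setBernoulli {e : Set (Fin n) | e.ncard = k} p

/-- The random variable `X_H`: the number of copies of `H` in the random `k`-graph, as a function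
of the edge set of the latter. -/
noncomputable def X {α : Type u} (H : Hypergraph α) (n : ℕ) (S : Set (Set (Fin n))) : ℝ :=
  (copyCount H (ofEdgeSet n S) : ℝ)

/-- The expectation of `X_H`. -/
noncomputable def EX {α : Type u} (k : ℕ) (H : Hypergraph α) (n : ℕ) (p : unitInterval) : ℝ :=
  ∫ S, X H n S ∂(randomEdges k n p)

/-- `Φ_H`, the minimum of the expectations of `X_J` over all subgraphs `J` of `H` with at least one
edge. For a `k`-graph `H` with an edge, this is the infimum of a finite nonempty set of reals. -/
noncomputable def Phi {α : Type u} (k : ℕ) (H : Hypergraph α) (n : ℕ) (p : unitInterval) : ℝ :=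
  sInf {x : ℝ | ∃ J : Hypergraph α, IsSubgraph J H ∧ J.edgeSet.Nonempty ∧ x = EX k J n p}

/-- The lower tail probability that `X_H ≤ (1 - ε) E X_H`. -/
noncomputable def lowerTail {α : Type u} (k : ℕ) (H : Hypergraph α) (n : ℕ) (p : unitInterval)
    (ε : ℝ) : ℝ :=
  (randomEdges k n p).real {S | X H n S ≤ (1 - ε) * EX k H n p}

end LowerTail

/-!
The lower tail of `X_H` has the order `ε ^ 2 Φ_H` in the exponent because `1 / Φ_H` is the order
of the relative variance of `X_H`, up to powers of `1 - p`.

Up to the factor `|Aut H|`, the number of copies of `H` is the number of injective vertex maps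
that send the edges of `H` to edges of the random `k`-graph (`embCount_eq`), which is a sum of
increasing indicators `ind (edgeImage k E φ)` over a finite product space. Up to constants, `Φ_H`
is the minimum `Ψ` of `n ^ |V(K)| * p ^ |K|` over the nonempty edge sets `K` of `H`, where `V(K)`
is the set of vertices covered by `K` (`Phi_le_blockMean`, `le_Phi`). The estimate that links the
overlaps of embeddings to `Ψ` is `sum_pow_card_edgeImage_sdiff_le`: given the presence of
boundedly many edges, the expected number of embeddings that use at least one of them is at most a
constant times the unconditional expectation divided by `Ψ`.

The upper bound is Janson's inequality (`janson`), deduced here from Harris' inequality, with this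
estimate for its variance proxy (`upper_bound_embCount`).

For the lower bound, let `K₀` attain the minimum `Ψ`, and let `u = |V(K₀)|`. The vertices of the
random `k`-graph are split into `b` residue classes, and the embeddings into `b ^ u` blocks
according to the classes of the images of the vertices in `V(K₀)`. In such a block the expected
subgraph counts are all at least of the order of `Ψ / b ^ u`, and the one of `K₀` is of this
order. Hence the relative standard deviation of the number of embeddings in the block is of the
order of `((1 - p) * b ^ u / Ψ) ^ (1 / 2)`, and its fourth moment is comparable to its squared
variance, up to powers of `1 - p`. For `b ^ u` of the order of `ε ^ 2 * Ψ / (1 - p) ^ 3`, the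
number of embeddings in a block therefore falls short of its mean by the factor `1 - ε` with a
probability of at least the order of `(1 - p) ^ 2` (`le_prob_block`). These are decreasing events,
so by Harris' inequality they occur simultaneously in all blocks with probability at least
`exp (-C * ε ^ 2 * Ψ / (1 - p) ^ 5)` (`pow_le_prob_embCount`). When there is no room for so many
blocks, and when `ε = 1`, the probability that no copy of `K₀` is present suffices
(`exp_le_prob_embCount_eq_zero`).
-/

namespace LowerTail

/-! ### Finite product measures -/

section FiniteProduct

variable {ι : Type*}

lemma indicator_one_nonneg (D : Set (Finset ι)) (S : Finset ι) : (0 : ℝ) ≤ D.indicator 1 S :=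
  Set.indicator_nonneg (fun _ _ => zero_le_one) S

variable [DecidableEq ι]

/-- The indicator of the event that the random set contains `A`. -/
noncomputable def ind (A S : Finset ι) : ℝ := if A ⊆ S then 1 else 0

lemma ind_nonneg (A S : Finset ι) : 0 ≤ ind A S := by unfold ind; split <;> norm_num

lemma ind_mul_ind (A B S : Finset ι) : ind A S * ind B S = ind (A ∪ B) S := by
  by_cases hA : A ⊆ S <;> by_cases hB : B ⊆ S <;> simp [ind, Finset.union_subset_iff, hA, hB]

lemma ind_empty (S : Finset ι) : ind ∅ S = 1 := by simp [ind]

lemma monotone_ind (A : Finset ι) : Monotone (ind A) := by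
  intro S T h
  by_cases hA : A ⊆ S
  · simp [ind, hA, hA.trans h]
  · simpa [ind, hA] using ind_nonneg A T

variable [Fintype ι]

/-- The probability of `S` under the law of a random subset of `ι` that contains each element
independently with probability `p`. -/
noncomputable def weight (p : ℝ) (S : Finset ι) : ℝ := p ^ S.card * (1 - p) ^ Sᶜ.card

/-- The expectation of `f` of a random subset of `ι` that contains each element independently with
probability `p`. -/
noncomputable def expect (p : ℝ) (f : Finset ι → ℝ) : ℝ := ∑ S, weight p S * f S

/-- The probability that a random subset of `ι`, containing each element independently with
probability `p`, lies in `D`. -/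
noncomputable def prob (p : ℝ) (D : Set (Finset ι)) : ℝ := expect p (D.indicator 1)

variable {p : ℝ}

lemma weight_nonneg (hp0 : 0 ≤ p) (hp1 : p ≤ 1) (S : Finset ι) : 0 ≤ weight p S := by
  have : 0 ≤ 1 - p := by linarith
  unfold weight; positivity

lemma weight_mul_weight (S T : Finset ι) :
    weight p S * weight p T = weight p (S ∩ T) * weight p (S ∪ T) := by
  unfold weight
  have h1 := Finset.card_union_add_card_inter S T
  have h2 := Finset.card_union_add_card_inter Sᶜ Tᶜ
  rw [← Finset.compl_inter, ← Finset.compl_union] at h2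
  calc _ = p ^ (S.card + T.card) * (1 - p) ^ (Sᶜ.card + Tᶜ.card) := by rw [pow_add, pow_add]; ring
    _ = _ := by rw [← h1, ← h2, pow_add, pow_add]; ring

lemma expect_const (c : ℝ) : expect p (fun _ : Finset ι => c) = c := by
  unfold expect weight
  rw [← Finset.sum_mul]
  simp_rw [Finset.card_compl]
  rw [Fintype.sum_pow_mul_eq_add_pow]
  simp

lemma expect_add (f g : Finset ι → ℝ) :
    expect p (fun S => f S + g S) = expect p f + expect p g := by
  simp [expect, mul_add, Finset.sum_add_distrib]

lemma expect_sub (f g : Finset ι → ℝ) :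
    expect p (fun S => f S - g S) = expect p f - expect p g := by
  simp [expect, mul_sub, Finset.sum_sub_distrib]

lemma expect_const_mul (c : ℝ) (f : Finset ι → ℝ) :
    expect p (fun S => c * f S) = c * expect p f := by
  simp only [expect, Finset.mul_sum]
  exact Finset.sum_congr rfl fun S _ => by ring

lemma expect_sum {κ : Type*} (T : Finset κ) (f : κ → Finset ι → ℝ) :
    expect p (fun S => ∑ i ∈ T, f i S) = ∑ i ∈ T, expect p (f i) := by
  simp only [expect, Finset.mul_sum]
  exact Finset.sum_comm

lemma expect_mono (hp0 : 0 ≤ p) (hp1 : p ≤ 1) {f g : Finset ι → ℝ} (h : ∀ S, f S ≤ g S) :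
    expect p f ≤ expect p g :=
  Finset.sum_le_sum fun S _ => mul_le_mul_of_nonneg_left (h S) (weight_nonneg hp0 hp1 S)

lemma expect_nonneg (hp0 : 0 ≤ p) (hp1 : p ≤ 1) {f : Finset ι → ℝ} (h : ∀ S, 0 ≤ f S) :
    0 ≤ expect p f :=
  Finset.sum_nonneg fun S _ => mul_nonneg (weight_nonneg hp0 hp1 S) (h S)

lemma prob_nonneg (hp0 : 0 ≤ p) (hp1 : p ≤ 1) (D : Set (Finset ι)) : 0 ≤ prob p D :=
  expect_nonneg hp0 hp1 (indicator_one_nonneg D)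

lemma prob_mono (hp0 : 0 ≤ p) (hp1 : p ≤ 1) {D D' : Set (Finset ι)} (h : D ⊆ D') :
    prob p D ≤ prob p D' :=
  expect_mono hp0 hp1 fun S =>
    Set.indicator_le_indicator_of_subset h (fun _ => zero_le_one) S

lemma prob_le_one (hp0 : 0 ≤ p) (hp1 : p ≤ 1) (D : Set (Finset ι)) : prob p D ≤ 1 := by
  calc prob p D ≤ expect p (fun _ => 1) :=
        expect_mono hp0 hp1 fun S => Set.indicator_le_self' (fun _ _ => zero_le_one) S
    _ = 1 := expect_const 1

lemma expect_ind_singleton_mul (a : ι) (g : Finset ι → ℝ) (hg : ∀ S, g (insert a S) = g S) :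
    expect p (fun S => ind {a} S * g S) = p * expect p g := by
  have key : ∑ S : Finset ι with a ∈ S, weight p S * g S
      = ∑ S : Finset ι with a ∉ S, weight p (insert a S) * g S := by
    refine Finset.sum_bij' (fun S _ => S.erase a) (fun S _ => insert a S) ?_ ?_ ?_ ?_ ?_
    · simp
    · simp
    · intro S hS; exact Finset.insert_erase (by simpa using hS)
    · intro S hS; exact Finset.erase_insert (by simpa using hS)
    · intro S hS
      have hS' : a ∈ S := by simpa using hS
      have := hg (S.erase a)
      rw [Finset.insert_erase hS'] at this ⊢
      rw [this]
  have hw : ∀ S : Finset ι, a ∉ S → (1 - p) * weight p (insert a S) = p * weight p S := by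
    intro S hS
    have h1 : Sᶜ.card = ((insert a S)ᶜ).card + 1 := by
      rw [Finset.compl_insert, Finset.card_erase_add_one (by simpa using hS)]
    unfold weight
    rw [Finset.card_insert_of_notMem hS, h1]
    ring
  have h2 : (1 - p) * ∑ S : Finset ι with a ∈ S, weight p S * g S
      = p * ∑ S : Finset ι with a ∉ S, weight p S * g S := by
    rw [key, Finset.mul_sum, Finset.mul_sum]
    refine Finset.sum_congr rfl fun S hS => ?_
    rw [← mul_assoc, hw S (by simpa using hS), mul_assoc]
  have h3 : expect p g = (∑ S : Finset ι with a ∈ S, weight p S * g S)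
      + ∑ S : Finset ι with a ∉ S, weight p S * g S :=
    (Finset.sum_filter_add_sum_filter_not _ _ _).symm
  have h4 : expect p (fun S => ind {a} S * g S)
      = ∑ S : Finset ι with a ∈ S, weight p S * g S := by
    rw [expect, Finset.sum_filter]
    refine Finset.sum_congr rfl fun S _ => ?_
    by_cases h : a ∈ S <;> simp [ind, h]
  rw [h4, h3]
  linear_combination h2

/-- The event that the random set contains `A` is independent of every function that does not
depend on the elements of `A`. -/
lemma expect_ind_mul (A : Finset ι) (g : Finset ι → ℝ)
    (hg : ∀ a ∈ A, ∀ S, g (insert a S) = g S) :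
    expect p (fun S => ind A S * g S) = p ^ A.card * expect p g := by
  induction A using Finset.induction_on with
  | empty => simp [ind_empty]
  | insert a A ha ih =>
    have h1 : ∀ S, ind (insert a A) S * g S = ind {a} S * (ind A S * g S) := fun S => by
      rw [← mul_assoc, ind_mul_ind, Finset.insert_eq]
    simp_rw [h1]
    rw [expect_ind_singleton_mul, ih fun b hb => hg b (Finset.mem_insert_of_mem hb),
      Finset.card_insert_of_notMem ha]
    · ring
    · intro S
      rw [hg a (Finset.mem_insert_self a A)]
      simp only [ind, Finset.subset_insert_iff_of_notMem ha]

lemma expect_ind (A : Finset ι) : expect p (ind A) = p ^ A.card := by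
  have := expect_ind_mul (p := p) A (fun _ => 1) fun _ _ _ => rfl
  simpa [expect_const] using this

/-- **Harris' inequality** for two decreasing functions, conditionally on the event that the random
set contains `A`. -/
lemma harris_cond (hp0 : 0 ≤ p) (hp1 : p ≤ 1) (A : Finset ι) {f g : Finset ι → ℝ}
    (hf0 : ∀ S, 0 ≤ f S) (hg0 : ∀ S, 0 ≤ g S) (hf : Antitone f) (hg : Antitone g) :
    expect p (fun S => ind A S * f S) * expect p (fun S => ind A S * g S)
      ≤ p ^ A.card * expect p (fun S => ind A S * (f S * g S)) := by
  have h := fkg (α := (Finset ι)ᵒᵈ)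
    (μ := fun S => weight p (OrderDual.ofDual S) * ind A (OrderDual.ofDual S))
    (f := fun S => f (OrderDual.ofDual S)) (g := fun S => g (OrderDual.ofDual S))
    (fun S => mul_nonneg (weight_nonneg hp0 hp1 _) (ind_nonneg _ _))
    (fun S => hf0 _) (fun S => hg0 _) (fun _ _ hST => hf hST) (fun _ _ hST => hg hST) ?_
  · rw [← expect_ind A]
    unfold expect
    simp only [mul_assoc] at h ⊢
    exact h
  · intro S T
    have e1 : OrderDual.ofDual (S ⊓ T) = OrderDual.ofDual S ∪ OrderDual.ofDual T := rfl
    have e2 : OrderDual.ofDual (S ⊔ T) = OrderDual.ofDual S ∩ OrderDual.ofDual T := rfl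
    simp only [e1, e2]
    generalize OrderDual.ofDual S = S
    generalize OrderDual.ofDual T = T
    have hw := weight_mul_weight (p := p) S T
    have hi : ind A S * ind A T ≤ ind A (S ∪ T) * ind A (S ∩ T) := by
      by_cases h1 : A ⊆ S
      · by_cases h2 : A ⊆ T
        · simp [ind, h1, h2, Finset.subset_inter, h1.trans Finset.subset_union_left]
        · simpa [ind, h1, h2] using mul_nonneg (ind_nonneg A (S ∪ T)) (ind_nonneg A (S ∩ T))
      · simpa [ind, h1] using mul_nonneg (ind_nonneg A (S ∪ T)) (ind_nonneg A (S ∩ T))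
    have hn : 0 ≤ weight p S * weight p T :=
      mul_nonneg (weight_nonneg hp0 hp1 _) (weight_nonneg hp0 hp1 _)
    calc _ = (weight p S * weight p T) * (ind A S * ind A T) := by ring
      _ ≤ (weight p S * weight p T) * (ind A (S ∪ T) * ind A (S ∩ T)) := by gcongr
      _ = _ := by rw [hw]; ring

/-- **Harris' inequality** for two decreasing functions. -/
lemma harris (hp0 : 0 ≤ p) (hp1 : p ≤ 1) {f g : Finset ι → ℝ}
    (hf0 : ∀ S, 0 ≤ f S) (hg0 : ∀ S, 0 ≤ g S) (hf : Antitone f) (hg : Antitone g) :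
    expect p f * expect p g ≤ expect p (fun S => f S * g S) := by
  simpa [ind_empty] using harris_cond hp0 hp1 ∅ hf0 hg0 hf hg

/-- **Harris' inequality** for finitely many decreasing events. -/
lemma prod_prob_le_prob_iInter (hp0 : 0 ≤ p) (hp1 : p ≤ 1) {κ : Type*} (T : Finset κ)
    (D : κ → Set (Finset ι)) (hD : ∀ i ∈ T, IsLowerSet (D i)) :
    ∏ i ∈ T, prob p (D i) ≤ prob p {S | ∀ i ∈ T, S ∈ D i} := by
  classical
  have hanti : ∀ D : Set (Finset ι), IsLowerSet D → Antitone (D.indicator (1 : Finset ι → ℝ)) := by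
    intro D hD S S' h
    by_cases hS : S' ∈ D
    · simp [hS, hD h hS]
    · rw [Set.indicator_of_notMem hS]; exact indicator_one_nonneg D S
  induction T using Finset.induction_on with
  | empty => simp [prob, Pi.one_def, expect_const]
  | insert a T ha ih =>
    rw [Finset.prod_insert ha]
    have hD' := fun i hi => hD i (Finset.mem_insert_of_mem hi)
    have hT : IsLowerSet {S | ∀ i ∈ T, S ∈ D i} := fun S S' h hS i hi => hD' i hi h (hS i hi)
    calc _ ≤ prob p (D a) * prob p {S | ∀ i ∈ T, S ∈ D i} :=
          mul_le_mul_of_nonneg_left (ih hD') (prob_nonneg hp0 hp1 _)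
      _ ≤ expect p (fun S => (D a).indicator 1 S * Set.indicator {S | ∀ i ∈ T, S ∈ D i} 1 S) :=
          harris hp0 hp1 (indicator_one_nonneg _) (indicator_one_nonneg _)
            (hanti _ (hD a (Finset.mem_insert_self a T))) (hanti _ hT)
      _ = _ := by
          unfold prob
          congr 1
          ext S
          by_cases h1 : S ∈ D a <;> by_cases h2 : ∀ i ∈ T, S ∈ D i <;>
            simp [Set.indicator, h1, h2]

end FiniteProduct

/-! ### Janson's inequality -/

section Janson

variable {ι κ : Type*} [DecidableEq ι] [Fintype ι] {p : ℝ}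

/-- The differential inequality behind Janson's inequality: with `X = ∑ i ∈ T, ind (A i)`, the left
hand side is minus the derivative of the Laplace transform of `X` at `s`. -/
lemma le_sum_expect_ind_mul_exp (hp0 : 0 < p) (hp1 : p ≤ 1) (T : Finset κ) (A : κ → Finset ι)
    {Λ s : ℝ} (hs : 0 ≤ s)
    (hΛ : ∑ i ∈ T, ∑ j ∈ T with ¬ Disjoint (A i) (A j), p ^ (A i ∪ A j).card ≤ Λ) :
    (∑ i ∈ T, p ^ (A i).card - s * Λ) * expect p (fun S => Real.exp (-(s * ∑ j ∈ T, ind (A j) S)))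
      ≤ ∑ i ∈ T, expect p (fun S => ind (A i) S * Real.exp (-(s * ∑ j ∈ T, ind (A j) S))) := by
  set F := expect p (fun S => Real.exp (-(s * ∑ j ∈ T, ind (A j) S))) with hF
  have hF0 : 0 ≤ F := expect_nonneg hp0.le hp1 fun S => (Real.exp_pos _).le
  have hanti : ∀ Q : Finset κ, Antitone fun S => Real.exp (-(s * ∑ j ∈ Q, ind (A j) S)) := by
    intro Q S S' h
    have : ∑ j ∈ Q, ind (A j) S ≤ ∑ j ∈ Q, ind (A j) S' :=
      Finset.sum_le_sum fun j _ => monotone_ind (A j) h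
    dsimp only
    gcongr
  have step : ∀ i ∈ T, (p ^ (A i).card
      - s * ∑ j ∈ T with ¬ Disjoint (A i) (A j), p ^ (A i ∪ A j).card) * F
      ≤ expect p (fun S => ind (A i) S * Real.exp (-(s * ∑ j ∈ T, ind (A j) S))) := by
    intro i _
    set Q := T.filter fun j => ¬ Disjoint (A i) (A j)
    set R := T.filter fun j => Disjoint (A i) (A j)
    have hsplit : ∀ S, ∑ j ∈ T, ind (A j) S = ∑ j ∈ Q, ind (A j) S + ∑ j ∈ R, ind (A j) S :=
      fun S => (Finset.sum_filter_not_add_sum_filter T (fun j => Disjoint (A i) (A j)) _).symm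
    have hpos : 0 < p ^ (A i).card := by positivity
    -- Conditionally on `A i`, the factors from the indices in `Q` and in `R` are positively
    -- correlated, and the latter factor is independent of `A i`.
    have h1 := harris_cond hp0.le hp1 (A i) (fun S => (Real.exp_pos _).le)
      (fun S => (Real.exp_pos _).le) (hanti Q) (hanti R)
    have h2 : expect p (fun S => ind (A i) S * Real.exp (-(s * ∑ j ∈ R, ind (A j) S)))
        = p ^ (A i).card * expect p (fun S => Real.exp (-(s * ∑ j ∈ R, ind (A j) S))) := by
      refine expect_ind_mul _ _ fun a ha S => ?_
      congr 3
      refine Finset.sum_congr rfl fun j hj => ?_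
      have : a ∉ A j := Finset.disjoint_left.1 (Finset.mem_filter.1 hj).2 ha
      simp only [ind, Finset.subset_insert_iff_of_notMem this]
    have h3 : F ≤ expect p (fun S => Real.exp (-(s * ∑ j ∈ R, ind (A j) S))) := by
      refine expect_mono hp0.le hp1 fun S => ?_
      rw [hsplit]
      have : 0 ≤ ∑ j ∈ Q, ind (A j) S := Finset.sum_nonneg fun j _ => ind_nonneg _ _
      gcongr
      linarith
    have h4 : p ^ (A i).card - s * ∑ j ∈ Q, p ^ (A i ∪ A j).card
        ≤ expect p (fun S => ind (A i) S * Real.exp (-(s * ∑ j ∈ Q, ind (A j) S))) := by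
      have e : p ^ (A i).card - s * ∑ j ∈ Q, p ^ (A i ∪ A j).card
          = expect p (fun S => ind (A i) S - s * ∑ j ∈ Q, ind (A i ∪ A j) S) := by
        rw [expect_sub, expect_const_mul, expect_sum, expect_ind]
        simp_rw [expect_ind]
      rw [e]
      refine expect_mono hp0.le hp1 fun S => ?_
      simp_rw [← ind_mul_ind]
      rw [← Finset.mul_sum]
      have := Real.add_one_le_exp (-(s * ∑ j ∈ Q, ind (A j) S))
      nlinarith [ind_nonneg (A i) S]
    have h5 : expect p (fun S => ind (A i) S * Real.exp (-(s * ∑ j ∈ T, ind (A j) S)))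
        = expect p (fun S => ind (A i) S * (Real.exp (-(s * ∑ j ∈ Q, ind (A j) S))
          * Real.exp (-(s * ∑ j ∈ R, ind (A j) S)))) := by
      congr 1
      ext S
      rw [hsplit, ← Real.exp_add]
      congr 2
      ring
    rw [h5]
    rw [h2] at h1
    have h6 := expect_nonneg hp0.le hp1 (f := fun S => ind (A i) S *
      Real.exp (-(s * ∑ j ∈ Q, ind (A j) S))) fun S =>
        mul_nonneg (ind_nonneg _ _) (Real.exp_pos _).le
    refine le_of_mul_le_mul_left (le_trans ?_ h1) hpos
    calc _ ≤ p ^ (A i).card * (expect p (fun S => ind (A i) S *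
            Real.exp (-(s * ∑ j ∈ Q, ind (A j) S))) * F) := by gcongr
      _ ≤ p ^ (A i).card * (expect p (fun S => ind (A i) S *
            Real.exp (-(s * ∑ j ∈ Q, ind (A j) S)))
            * expect p (fun S => Real.exp (-(s * ∑ j ∈ R, ind (A j) S)))) := by gcongr
      _ = _ := by ring
  calc _ ≤ (∑ i ∈ T, p ^ (A i).card
        - s * ∑ i ∈ T, ∑ j ∈ T with ¬ Disjoint (A i) (A j), p ^ (A i ∪ A j).card) * F := by gcongr
    _ = ∑ i ∈ T, (p ^ (A i).card
        - s * ∑ j ∈ T with ¬ Disjoint (A i) (A j), p ^ (A i ∪ A j).card) * F := by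
        rw [← Finset.sum_mul, Finset.sum_sub_distrib, Finset.mul_sum]
    _ ≤ _ := Finset.sum_le_sum step

/-- **Janson's inequality** for the number of indices `i ∈ T` such that the random set contains
`A i`. -/
theorem janson (hp0 : 0 < p) (hp1 : p ≤ 1) (T : Finset κ) (A : κ → Finset ι)
    {Λ t : ℝ} (hΛ0 : 0 < Λ) (ht : 0 ≤ t)
    (hΛ : ∑ i ∈ T, ∑ j ∈ T with ¬ Disjoint (A i) (A j), p ^ (A i ∪ A j).card ≤ Λ) :
    prob p {S | ∑ i ∈ T, ind (A i) S ≤ ∑ i ∈ T, p ^ (A i).card - t}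
      ≤ Real.exp (-(t ^ 2 / (2 * Λ))) := by
  set μ := ∑ i ∈ T, p ^ (A i).card
  set X : Finset ι → ℝ := fun S => ∑ i ∈ T, ind (A i) S with hX
  set F : ℝ → ℝ := fun s => expect p (fun S => Real.exp (-(s * X S))) with hF
  have hderiv : ∀ s, HasDerivAt F (-∑ i ∈ T, expect p (fun S => ind (A i) S *
      Real.exp (-(s * X S)))) s := by
    intro s
    have e : -∑ i ∈ T, expect p (fun S => ind (A i) S * Real.exp (-(s * X S)))
        = ∑ S, weight p S * (Real.exp (-(s * X S)) * (-(1 * X S))) := by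
      rw [← expect_sum, expect, ← Finset.sum_neg_distrib]
      refine Finset.sum_congr rfl fun S _ => ?_
      rw [← Finset.sum_mul]
      simp only [hX]
      ring
    rw [e]
    refine HasDerivAt.fun_sum fun S _ => HasDerivAt.const_mul _ ?_
    exact (((hasDerivAt_id s).mul_const (X S)).neg).exp
  set h : ℝ → ℝ := fun s => F s * Real.exp (μ * s - s ^ 2 * Λ / 2) with hh
  have hderiv' : ∀ s, HasDerivAt h ((-∑ i ∈ T, expect p (fun S => ind (A i) S *
      Real.exp (-(s * X S)))) * Real.exp (μ * s - s ^ 2 * Λ / 2)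
      + F s * (Real.exp (μ * s - s ^ 2 * Λ / 2) * (μ - s * Λ))) s := by
    intro s
    refine (hderiv s).mul (HasDerivAt.exp ?_)
    have h1 := ((hasDerivAt_id s).const_mul μ).sub
      ((((hasDerivAt_id s).pow 2).mul_const Λ).div_const 2)
    refine h1.congr_deriv ?_
    simp; ring
  have hmono : AntitoneOn h (Set.Ici 0) := by
    refine antitoneOn_of_deriv_nonpos (convex_Ici 0)
      (fun s _ => (hderiv' s).continuousAt.continuousWithinAt)
      (fun s _ => (hderiv' s).differentiableAt.differentiableWithinAt) fun s hs => ?_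
    rw [interior_Ici] at hs
    rw [(hderiv' s).deriv]
    have := le_sum_expect_ind_mul_exp hp0 hp1 T A (le_of_lt hs) hΛ
    have hpos := Real.exp_pos (μ * s - s ^ 2 * Λ / 2)
    have h2 : (μ - s * Λ) * F s ≤ ∑ i ∈ T, expect p (fun S => ind (A i) S *
      Real.exp (-(s * X S))) := this
    nlinarith
  have hbound : ∀ s, 0 ≤ s → F s ≤ Real.exp (-(μ * s) + s ^ 2 * Λ / 2) := by
    intro s hs
    have h1 := hmono (Set.mem_Ici.2 le_rfl) (Set.mem_Ici.2 hs) hs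
    have h0 : h 0 = 1 := by simp [hh, hF, expect_const]
    rw [h0] at h1
    have e : -(μ * s) + s ^ 2 * Λ / 2 = -(μ * s - s ^ 2 * Λ / 2) := by ring
    rw [e, Real.exp_neg, ← one_div, le_div_iff₀ (Real.exp_pos _)]
    exact h1
  have hs0 : 0 ≤ t / Λ := by positivity
  calc prob p {S | X S ≤ μ - t}
      ≤ expect p (fun S => Real.exp (t / Λ * (μ - t)) * Real.exp (-(t / Λ * X S))) := by
        refine expect_mono hp0.le hp1 fun S => ?_
        rw [← Real.exp_add]
        by_cases hS : X S ≤ μ - t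
        · rw [Set.indicator_of_mem (by exact hS)]
          refine Real.one_le_exp ?_
          nlinarith
        · rw [Set.indicator_of_notMem (by exact hS)]
          exact (Real.exp_pos _).le
    _ = Real.exp (t / Λ * (μ - t)) * F (t / Λ) := expect_const_mul _ _
    _ ≤ Real.exp (t / Λ * (μ - t)) * Real.exp (-(μ * (t / Λ)) + (t / Λ) ^ 2 * Λ / 2) := by
        gcongr
        exact hbound _ hs0
    _ = _ := by
        rw [← Real.exp_add]
        congr 1
        field_simp
        ring

end Janson

/-! ### One-sided anticoncentration -/

section Anticoncentration

variable {ι κ : Type*} [DecidableEq ι] [Fintype ι] {p : ℝ}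

/-- A centred random variable whose fourth moment is comparable to its squared variance lies a
standard deviation below its mean with probability bounded from below. -/
lemma le_prob_le_neg (hp0 : 0 ≤ p) (hp1 : p ≤ 1) (Y : Finset ι → ℝ) {m t : ℝ}
    (hY : expect p Y = 0) (hx : 0 < expect p (fun S => Y S ^ 2))
    (hm : expect p (fun S => Y S ^ 4) ≤ m) (ht : 0 ≤ t)
    (htm : t ^ 2 * (128 * m) ≤ expect p (fun S => Y S ^ 2) ^ 3) :
    expect p (fun S => Y S ^ 2) ^ 2 / (128 * m) ≤ prob p {S | Y S ≤ -t} := by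
  set x := expect p (fun S => Y S ^ 2) with hxdef
  have hm0 : 0 < m := by
    have h1 : 0 ≤ expect p (fun S => (Y S ^ 2 - x) ^ 2) :=
      expect_nonneg hp0 hp1 fun S => sq_nonneg _
    have h2 : (fun S => (Y S ^ 2 - x) ^ 2) = fun S => (Y S ^ 4 - 2 * x * Y S ^ 2) + x ^ 2 := by
      ext S; ring
    rw [h2, expect_add, expect_sub, expect_const, expect_const_mul, ← hxdef] at h1
    nlinarith
  -- The scale at which the contribution of large values of `Y` is cut off.
  set a := Real.sqrt (2 * m / x) with ha
  have ha0 : 0 < a := Real.sqrt_pos.2 (by positivity)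
  have ha2 : a ^ 2 = 2 * m / x := Real.sq_sqrt (by positivity)
  have ham : m = a ^ 2 * x / 2 := by rw [ha2]; field_simp
  have hta : t ≤ x / (8 * a) := by
    refine le_of_sq_le_sq ?_ (by positivity)
    rw [ham] at htm
    rw [div_pow, le_div_iff₀ (by positivity)]
    have : x * (t ^ 2 * (8 * a) ^ 2) ≤ x * x ^ 2 := by nlinarith
    exact le_of_mul_le_mul_left this hx
  set pr := prob p {S | Y S ≤ -t} with hpr
  -- Pointwise `|y| ≥ y ^ 2 / a - y ^ 4 / a ^ 3`, and `|Y|` has twice the expectation of `Y⁻`.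
  have hneg : x / a - m / a ^ 3 ≤ 2 * expect p (fun S => max (-Y S) 0) := by
    have e : 2 * expect p (fun S => max (-Y S) 0)
        = expect p (fun S => 2 * max (-Y S) 0 + Y S) := by
      rw [expect_add, expect_const_mul, hY, add_zero]
    have e2 : x / a - expect p (fun S => Y S ^ 4) / a ^ 3
        = expect p (fun S => a⁻¹ * Y S ^ 2 - (a ^ 3)⁻¹ * Y S ^ 4) := by
      rw [expect_sub, expect_const_mul, expect_const_mul]
      ring
    have h3 : m / a ^ 3 ≥ expect p (fun S => Y S ^ 4) / a ^ 3 := by gcongr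
    refine le_trans (by linarith) (e2.trans_le (le_trans (expect_mono hp0 hp1 fun S => ?_) e.ge))
    have habs : 2 * max (-Y S) 0 + Y S = |Y S| := by
      rcases le_total (Y S) 0 with h | h
      · rw [max_eq_left (by linarith), abs_of_nonpos h]; ring
      · rw [max_eq_right (by linarith), abs_of_nonneg h]; ring
    rw [habs, ← sq_abs (Y S), ← (show |Y S| ^ 4 = Y S ^ 4 from (by decide : Even 4).pow_abs _)]
    generalize hy : |Y S| = y
    have hy0 : 0 ≤ y := hy ▸ abs_nonneg _
    have e3 : a⁻¹ * y ^ 2 - (a ^ 3)⁻¹ * y ^ 4 = (y * y * (a ^ 2 - y ^ 2)) / a ^ 3 := by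
      field_simp
    rw [e3, div_le_iff₀ (by positivity)]
    rcases le_total y a with h | h
    · have : y * y * (a ^ 2 - y ^ 2) ≤ y * a * a ^ 2 := by
        have h1 : a ^ 2 - y ^ 2 ≤ a ^ 2 := by nlinarith
        have h2 : 0 ≤ a ^ 2 - y ^ 2 := by nlinarith
        gcongr
      nlinarith
    · have h1 : a ^ 2 - y ^ 2 ≤ 0 := by nlinarith
      have h2 : 0 ≤ y * a ^ 3 := by positivity
      nlinarith [mul_nonneg hy0 hy0]
  have hneg' : x / (4 * a) ≤ expect p (fun S => max (-Y S) 0) := by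
    have : x / a - m / a ^ 3 = 2 * (x / (4 * a)) := by
      rw [ham]; field_simp; ring
    linarith
  -- On the event `Y ≤ -t`, bound `Y⁻` by the arithmetic-geometric mean inequality.
  have hup : expect p (fun S => max (-Y S) 0) ≤ t + 1 / (16 * a) * x + 4 * a * pr := by
    have e : t + 1 / (16 * a) * x + 4 * a * pr
        = expect p (fun S => t + 1 / (16 * a) * Y S ^ 2
          + 4 * a * Set.indicator {S | Y S ≤ -t} 1 S) := by
      rw [expect_add, expect_add, expect_const, expect_const_mul, expect_const_mul]
      rfl
    rw [e]
    refine expect_mono hp0 hp1 fun S => ?_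
    have hsq : 0 ≤ 1 / (16 * a) * Y S ^ 2 := by positivity
    by_cases hS : Y S ≤ -t
    · rw [Set.indicator_of_mem (by exact hS), max_eq_left (by linarith)]
      have : 1 / (16 * a) * Y S ^ 2 + 4 * a + Y S = (Y S + 8 * a) ^ 2 / (16 * a) := by
        field_simp; ring
      have h2 : 0 ≤ (Y S + 8 * a) ^ 2 / (16 * a) := by positivity
      simp only [Pi.one_apply]
      linarith
    · rw [Set.indicator_of_notMem (by exact hS)]
      have : max (-Y S) 0 ≤ t := max_le (by linarith) ht
      linarith
  have hfin : x / (16 * a) ≤ 4 * a * pr := by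
    have e1 : x / (4 * a) - x / (8 * a) - 1 / (16 * a) * x = x / (16 * a) := by
      field_simp; ring
    linarith
  have e2 : x ^ 2 / (128 * m) = x / (16 * a) / (4 * a) := by
    rw [ham]; field_simp; ring
  rw [e2, div_le_iff₀ (by positivity)]
  linarith

end Anticoncentration

/-! ### Moments of sums of centred indicators -/

section Moments

variable {ι κ : Type*} [DecidableEq ι]

lemma ind_insert_of_notMem {A : Finset ι} {a : ι} (ha : a ∉ A) (S : Finset ι) :
    ind A (insert a S) = ind A S := by
  simp only [ind, Finset.subset_insert_iff_of_notMem ha]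

variable [Fintype ι] {p : ℝ}

lemma expect_centered_mul_eq_zero (A : Finset ι) (g : Finset ι → ℝ)
    (hg : ∀ a ∈ A, ∀ S, g (insert a S) = g S) :
    expect p (fun S => (ind A S - p ^ A.card) * g S) = 0 := by
  have : (fun S => (ind A S - p ^ A.card) * g S)
      = fun S => ind A S * g S - p ^ A.card * g S := by ext S; ring
  rw [this, expect_sub, expect_const_mul, expect_ind_mul A g hg, sub_self]

lemma expect_prod_centered_eq_zero {A B C D : Finset ι} {q : ℝ} (hq : q = p ^ A.card)
    (h : Disjoint A (B ∪ C ∪ D)) :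
    expect p (fun S => (ind A S - q) * ((ind B S - q) * (ind C S - q) * (ind D S - q))) = 0 := by
  subst hq
  refine expect_centered_mul_eq_zero A _ fun a ha S => ?_
  have := Finset.disjoint_left.1 h ha
  simp only [Finset.mem_union, not_or] at this
  rw [ind_insert_of_notMem this.1.1, ind_insert_of_notMem this.1.2, ind_insert_of_notMem this.2]

lemma expect_ind_mul_add_mul_le (hp0 : 0 ≤ p) (hp1 : p ≤ 1) {f : Finset ι → ℝ} {V : Finset ι}
    {c : ℝ} (hc : 0 ≤ c) (hf : ∀ B, expect p (fun S => ind B S * f S) ≤ c * p ^ (B ∪ V).card)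
    (A B : Finset ι) :
    expect p (fun S => ind B S * ((ind A S + p ^ A.card) * f S))
      ≤ 2 * c * p ^ (B ∪ (A ∪ V)).card := by
  have e : (fun S => ind B S * ((ind A S + p ^ A.card) * f S))
      = fun S => ind (B ∪ A) S * f S + p ^ A.card * (ind B S * f S) := by
    ext S; rw [← ind_mul_ind]; ring
  rw [e, expect_add, expect_const_mul]
  have h1 := hf (B ∪ A)
  have h2 : p ^ A.card * expect p (fun S => ind B S * f S)
      ≤ p ^ A.card * (c * p ^ (B ∪ V).card) := by
    gcongr; exact hf B
  have h3 : p ^ A.card * p ^ (B ∪ V).card ≤ p ^ (B ∪ (A ∪ V)).card := by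
    rw [← pow_add]
    refine pow_le_pow_of_le_one hp0 hp1 ?_
    rw [Finset.union_left_comm]
    exact Finset.card_union_le _ _
  rw [Finset.union_assoc] at h1
  nlinarith

lemma expect_prod_centered_le (hp0 : 0 ≤ p) (hp1 : p ≤ 1) {A B C D : Finset ι} {q : ℝ}
    (hA : q = p ^ A.card) (hB : q = p ^ B.card) (hC : q = p ^ C.card) (hD : q = p ^ D.card) :
    expect p (fun S => (ind A S - q) * ((ind B S - q) * (ind C S - q) * (ind D S - q)))
      ≤ 16 * p ^ (A ∪ B ∪ C ∪ D).card := by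
  have h0 : ∀ E : Finset ι, expect p (fun S => ind E S * (fun _ => (1 : ℝ)) S)
      ≤ 1 * p ^ (E ∪ ∅).card := fun E => by simpa using (expect_ind E).le
  have h1 := expect_ind_mul_add_mul_le hp0 hp1 zero_le_one h0 D
  have h2 := expect_ind_mul_add_mul_le hp0 hp1 (by norm_num) h1 C
  have h3 := expect_ind_mul_add_mul_le hp0 hp1 (by norm_num) h2 B
  have h4 := expect_ind_mul_add_mul_le hp0 hp1 (by norm_num) h3 A ∅
  rw [← hA, ← hB, ← hC, ← hD] at h4
  norm_num [ind_empty] at h4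
  rw [← Finset.union_assoc, ← Finset.union_assoc] at h4
  refine le_trans (expect_mono hp0 hp1 fun S => ?_) h4
  have hq : 0 ≤ q := hA ▸ pow_nonneg hp0 _
  have habs : ∀ E : Finset ι, |ind E S - q| ≤ ind E S + q := fun E => by
    have := ind_nonneg E S
    rw [abs_le]; constructor <;> linarith
  refine (le_abs_self _).trans ?_
  rw [abs_mul, abs_mul, abs_mul, mul_assoc |ind B S - q|]
  have hadd : ∀ E : Finset ι, 0 ≤ ind E S + q := fun E => (abs_nonneg _).trans (habs E)
  gcongr <;> first | apply habs | apply hadd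

/-- In the expansion of the fourth moment only those quadruples contribute in which every set meets
the union of the other three. Up to the order, the second set of such a quadruple meets the first,
and the fourth meets the union of the others; `a` and `b` then bound the number of ways to choose,
one after the other, an unrestricted set and a set that meets the union `F` of the earlier ones,
weighted by the conditional probability of occurrence. -/
lemma expect_sum_centered_pow_four_le (hp0 : 0 ≤ p) (hp1 : p ≤ 1) (T : Finset κ)
    (A : κ → Finset ι) {q a b : ℝ} (hA : ∀ i ∈ T, p ^ (A i).card = q)
    (ha0 : 0 ≤ a) (hb0 : 0 ≤ b)
    (ha : ∀ i ∈ T, ∀ j ∈ T, ∑ l ∈ T, p ^ (A l \ (A i ∪ A j)).card ≤ a)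
    (hb : ∀ i ∈ T, ∀ j ∈ T, ∀ k ∈ T,
      ∑ l ∈ T with ¬ Disjoint (A l) (A i ∪ A j ∪ A k), p ^ (A l \ (A i ∪ A j ∪ A k)).card ≤ b) :
    expect p (fun S => (∑ i ∈ T, (ind (A i) S - q)) ^ 4) ≤ 48 * (T.card * q) * a * b ^ 2 := by
  classical
  -- The contribution of the quadruples in the order described above.
  set R : κ → κ → κ → κ → ℝ := fun i j k l =>
    if ¬ Disjoint (A j) (A i) ∧ ¬ Disjoint (A l) (A i ∪ A j ∪ A k)
      then p ^ (A i ∪ A j ∪ A k ∪ A l).card else 0 with hR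
  have hR0 : ∀ i j k l, 0 ≤ R i j k l := fun i j k l => by
    simp only [hR]; split <;> positivity
  have hterm : ∀ i ∈ T, ∀ j ∈ T, ∀ k ∈ T, ∀ l ∈ T,
      expect p (fun S => (ind (A i) S - q) * (ind (A j) S - q) * (ind (A k) S - q)
        * (ind (A l) S - q)) ≤ 16 * (R i j k l + R i k j l + R i l j k) := by
    intro i hi j hj k hk l hl
    have p1 := hR0 i j k l
    have p2 := hR0 i k j l
    have p3 := hR0 i l j k
    have hi' := (hA i hi).symm
    have hj' := (hA j hj).symm
    have hk' := (hA k hk).symm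
    have hl' := (hA l hl).symm
    by_cases dI : Disjoint (A i) (A j ∪ A k ∪ A l)
    · have := expect_prod_centered_eq_zero hi' dI
      have e : ∀ S, (ind (A i) S - q) * (ind (A j) S - q) * (ind (A k) S - q) * (ind (A l) S - q)
          = (ind (A i) S - q) * ((ind (A j) S - q) * (ind (A k) S - q) * (ind (A l) S - q)) :=
        fun S => by ring
      simp_rw [e]
      linarith
    by_cases dK : Disjoint (A k) (A i ∪ A l ∪ A j)
    · have := expect_prod_centered_eq_zero hk' dK
      have e : ∀ S, (ind (A i) S - q) * (ind (A j) S - q) * (ind (A k) S - q) * (ind (A l) S - q)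
          = (ind (A k) S - q) * ((ind (A i) S - q) * (ind (A l) S - q) * (ind (A j) S - q)) :=
        fun S => by ring
      simp_rw [e]
      linarith
    by_cases dL : Disjoint (A l) (A i ∪ A j ∪ A k)
    · have := expect_prod_centered_eq_zero hl' dL
      have e : ∀ S, (ind (A i) S - q) * (ind (A j) S - q) * (ind (A k) S - q) * (ind (A l) S - q)
          = (ind (A l) S - q) * ((ind (A i) S - q) * (ind (A j) S - q) * (ind (A k) S - q)) :=
        fun S => by ring
      simp_rw [e]
      linarith
    have hle := expect_prod_centered_le hp0 hp1 hi' hj' hk' hl'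
    have e : ∀ S, (ind (A i) S - q) * (ind (A j) S - q) * (ind (A k) S - q) * (ind (A l) S - q)
        = (ind (A i) S - q) * ((ind (A j) S - q) * (ind (A k) S - q) * (ind (A l) S - q)) :=
      fun S => by ring
    simp_rw [e]
    refine hle.trans ?_
    rw [Finset.disjoint_union_right, Finset.disjoint_union_right, not_and_or, not_and_or] at dI
    rcases dI with (h | h) | h
    · have : R i j k l = p ^ (A i ∪ A j ∪ A k ∪ A l).card :=
        if_pos ⟨fun h' => h h'.symm, dL⟩
      linarith
    · have : R i k j l = p ^ (A i ∪ A j ∪ A k ∪ A l).card := by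
        have e : A i ∪ A k ∪ A j = A i ∪ A j ∪ A k := by ac_rfl
        simp only [hR, e]
        exact if_pos ⟨fun h' => h h'.symm, dL⟩
      linarith
    · have : R i l j k = p ^ (A i ∪ A j ∪ A k ∪ A l).card := by
        have e : A i ∪ A l ∪ A j ∪ A k = A i ∪ A j ∪ A k ∪ A l := by ac_rfl
        simp only [hR, e]
        exact if_pos ⟨fun h' => h h'.symm, dK⟩
      linarith
  have hsumR : ∑ i ∈ T, ∑ j ∈ T, ∑ k ∈ T, ∑ l ∈ T, R i j k l ≤ T.card * q * a * b ^ 2 := by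
    have hl : ∀ i ∈ T, ∀ j ∈ T, ∀ k ∈ T, ∑ l ∈ T, R i j k l
        ≤ if ¬ Disjoint (A j) (A i) then p ^ (A i ∪ A j ∪ A k).card * b else 0 := by
      intro i hi j hj k hk
      by_cases h : Disjoint (A j) (A i)
      · simp [hR, h]
      · rw [if_pos h]
        refine le_trans (le_of_eq ?_) (mul_le_mul_of_nonneg_left (hb i hi j hj k hk)
          (pow_nonneg hp0 _))
        rw [Finset.mul_sum, Finset.sum_filter]
        refine Finset.sum_congr rfl fun l _ => ?_
        simp only [hR, h, not_false_eq_true, true_and]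
        refine if_congr Iff.rfl ?_ rfl
        rw [← pow_add, ← Finset.union_sdiff_self_eq_union,
          Finset.card_union_of_disjoint Finset.disjoint_sdiff]
    have hk : ∀ i ∈ T, ∀ j ∈ T, ∑ k ∈ T, ∑ l ∈ T, R i j k l
        ≤ if ¬ Disjoint (A j) (A i) then p ^ (A i ∪ A j).card * a * b else 0 := by
      intro i hi j hj
      refine (Finset.sum_le_sum fun k hk => hl i hi j hj k hk).trans ?_
      by_cases h : Disjoint (A j) (A i)
      · simp [h]
      · simp only [h, not_false_eq_true, if_true]
        rw [← Finset.sum_mul]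
        refine mul_le_mul_of_nonneg_right ?_ hb0
        refine le_trans (le_of_eq ?_) (mul_le_mul_of_nonneg_left (ha i hi j hj)
          (pow_nonneg hp0 _))
        rw [Finset.mul_sum]
        refine Finset.sum_congr rfl fun k _ => ?_
        rw [← pow_add, ← Finset.union_sdiff_self_eq_union,
          Finset.card_union_of_disjoint Finset.disjoint_sdiff]
    have hj : ∀ i ∈ T, ∑ j ∈ T, ∑ k ∈ T, ∑ l ∈ T, R i j k l ≤ q * b * a * b := by
      intro i hi
      refine (Finset.sum_le_sum fun j hj => hk i hi j hj).trans ?_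
      have hb' := hb i hi i hi i hi
      simp only [Finset.union_self] at hb'
      rw [← Finset.sum_filter, ← Finset.sum_mul, ← Finset.sum_mul]
      refine mul_le_mul_of_nonneg_right (mul_le_mul_of_nonneg_right ?_ ha0) hb0
      refine le_trans (le_of_eq ?_) (mul_le_mul_of_nonneg_left hb'
          (hA i hi ▸ pow_nonneg hp0 (A i).card : (0 : ℝ) ≤ q))
      rw [Finset.mul_sum]
      refine Finset.sum_congr rfl fun k _ => ?_
      rw [← hA i hi, ← pow_add, ← Finset.union_sdiff_self_eq_union,
          Finset.card_union_of_disjoint Finset.disjoint_sdiff]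
    refine (Finset.sum_le_sum hj).trans (le_of_eq ?_)
    rw [Finset.sum_const, nsmul_eq_mul]
    ring
  have hexp : ∀ S, (∑ i ∈ T, (ind (A i) S - q)) ^ 4
      = ∑ i ∈ T, ∑ j ∈ T, ∑ k ∈ T, ∑ l ∈ T, (ind (A i) S - q) * (ind (A j) S - q)
        * (ind (A k) S - q) * (ind (A l) S - q) := by
    intro S
    simp only [← Finset.mul_sum, ← Finset.sum_mul]
    ring
  simp_rw [hexp, expect_sum]
  calc _ ≤ ∑ i ∈ T, ∑ j ∈ T, ∑ k ∈ T, ∑ l ∈ T, 16 * (R i j k l + R i k j l + R i l j k) :=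
        Finset.sum_le_sum fun i hi => Finset.sum_le_sum fun j hj => Finset.sum_le_sum fun k hk =>
          Finset.sum_le_sum fun l hl => hterm i hi j hj k hk l hl
    _ = 16 * (∑ i ∈ T, ∑ j ∈ T, ∑ k ∈ T, ∑ l ∈ T, R i j k l
        + ∑ i ∈ T, ∑ j ∈ T, ∑ k ∈ T, ∑ l ∈ T, R i k j l
        + ∑ i ∈ T, ∑ j ∈ T, ∑ k ∈ T, ∑ l ∈ T, R i l j k) := by
        simp_rw [← Finset.mul_sum, Finset.sum_add_distrib]
    _ = 48 * ∑ i ∈ T, ∑ j ∈ T, ∑ k ∈ T, ∑ l ∈ T, R i j k l := by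
        have e1 : ∑ i ∈ T, ∑ j ∈ T, ∑ k ∈ T, ∑ l ∈ T, R i k j l
            = ∑ i ∈ T, ∑ j ∈ T, ∑ k ∈ T, ∑ l ∈ T, R i j k l :=
          Finset.sum_congr rfl fun i _ => Finset.sum_comm
        have e2 : ∑ i ∈ T, ∑ j ∈ T, ∑ k ∈ T, ∑ l ∈ T, R i l j k
            = ∑ i ∈ T, ∑ j ∈ T, ∑ k ∈ T, ∑ l ∈ T, R i j k l := by
          refine Finset.sum_congr rfl fun i _ => ?_
          rw [Finset.sum_congr rfl fun j _ => Finset.sum_comm (f := fun k l => R i l j k)]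
          exact Finset.sum_comm
        rw [e1, e2]; ring
    _ ≤ _ := by nlinarith

lemma expect_sum_centered (T : Finset κ) (A : κ → Finset ι) {q : ℝ}
    (hA : ∀ i ∈ T, p ^ (A i).card = q) :
    expect p (fun S => ∑ i ∈ T, (ind (A i) S - q)) = 0 := by
  rw [expect_sum]
  refine Finset.sum_eq_zero fun i hi => ?_
  rw [expect_sub, expect_const, expect_ind, hA i hi, sub_self]

/-- A lower bound on the variance. All covariances are nonnegative, and those of pairs with the same
value of `r` are large, because such pairs share at least `c` elements. -/
lemma le_expect_sum_centered_sq {ρ : Type*} [DecidableEq ρ] (hp0 : 0 ≤ p) (hp1 : p ≤ 1)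
    (T : Finset κ)
    (A : κ → Finset ι) {e c : ℕ} (hA : ∀ i ∈ T, (A i).card = e) (hc : 0 < c) (r : κ → ρ)
    (R : Finset ρ) (hrR : ∀ i ∈ T, r i ∈ R)
    (hr : ∀ i ∈ T, ∀ j ∈ T, r i = r j → c ≤ (A i ∩ A j).card) :
    (T.card * p ^ e) ^ 2 * (1 - p)
      ≤ R.card * p ^ c * expect p (fun S => (∑ i ∈ T, (ind (A i) S - p ^ e)) ^ 2) := by
  have hexp : expect p (fun S => (∑ i ∈ T, (ind (A i) S - p ^ e)) ^ 2)
      = ∑ i ∈ T, ∑ j ∈ T, (p ^ (A i ∪ A j).card - p ^ (2 * e)) := by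
    have h1 : ∀ S, (∑ i ∈ T, (ind (A i) S - p ^ e)) ^ 2 = ∑ i ∈ T, ∑ j ∈ T,
        (ind (A i ∪ A j) S - p ^ e * ind (A j) S - (p ^ e * ind (A i) S - p ^ (2 * e))) := by
      intro S
      rw [pow_two, Finset.sum_mul_sum]
      refine Finset.sum_congr rfl fun i _ => Finset.sum_congr rfl fun j _ => ?_
      rw [← ind_mul_ind]; ring
    simp_rw [h1, expect_sum]
    refine Finset.sum_congr rfl fun i hi => Finset.sum_congr rfl fun j hj => ?_
    rw [expect_sub, expect_sub, expect_sub, expect_const_mul, expect_const_mul, expect_const,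
      expect_ind, expect_ind, expect_ind, hA i hi, hA j hj]
    ring
  have hcard : ∀ i ∈ T, ∀ j ∈ T, (A i ∪ A j).card + (A i ∩ A j).card = 2 * e := by
    intro i hi j hj
    rw [Finset.card_union_add_card_inter, hA i hi, hA j hj, two_mul]
  have hterm : ∀ i ∈ T, ∀ j ∈ T,
      (if r i = r j then p ^ (2 * e) * (1 - p) else 0)
        ≤ p ^ c * (p ^ (A i ∪ A j).card - p ^ (2 * e)) := by
    intro i hi j hj
    have hu := hcard i hi j hj
    split_ifs with h
    · have hcle := hr i hi j hj h
      have h1 : p ^ (A i ∪ A j).card * (1 - p) ≤ p ^ (A i ∪ A j).card - p ^ (2 * e) := by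
        have : p ^ (2 * e) ≤ p ^ ((A i ∪ A j).card + 1) :=
          pow_le_pow_of_le_one hp0 hp1 (by omega)
        rw [pow_succ] at this
        linarith
      have h2 : p ^ (2 * e) ≤ p ^ c * p ^ (A i ∪ A j).card := by
        rw [← pow_add]
        exact pow_le_pow_of_le_one hp0 hp1 (by omega)
      calc p ^ (2 * e) * (1 - p) ≤ p ^ c * p ^ (A i ∪ A j).card * (1 - p) :=
            mul_le_mul_of_nonneg_right h2 (by linarith)
        _ = p ^ c * (p ^ (A i ∪ A j).card * (1 - p)) := by ring
        _ ≤ _ := by gcongr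
    · have : p ^ (2 * e) ≤ p ^ (A i ∪ A j).card := pow_le_pow_of_le_one hp0 hp1 (by omega)
      exact mul_nonneg (pow_nonneg hp0 _) (by linarith)
  have hpairs : (T.card : ℝ) ^ 2 ≤ R.card * ∑ i ∈ T, ∑ j ∈ T, if r i = r j then (1 : ℝ) else 0 := by
    have h1 : (T.card : ℝ) = ∑ x ∈ R, ((T.filter fun i => r i = x).card : ℝ) := by
      rw [Finset.card_eq_sum_card_fiberwise (f := r) (t := R) hrR]
      push_cast; rfl
    have h2 : ∑ i ∈ T, ∑ j ∈ T, (if r i = r j then (1 : ℝ) else 0)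
        = ∑ x ∈ R, ((T.filter fun i => r i = x).card : ℝ) ^ 2 := by
      rw [← Finset.sum_fiberwise_of_maps_to hrR]
      refine Finset.sum_congr rfl fun x _ => ?_
      rw [Finset.sum_congr rfl (g := fun _ => ((T.filter fun i => r i = x).card : ℝ))]
      · rw [Finset.sum_const, nsmul_eq_mul, sq]
      · intro i hi
        rw [(Finset.mem_filter.1 hi).2, Finset.sum_boole]
        simp only [eq_comm]
    rw [h2, h1]
    exact sq_sum_le_card_mul_sum_sq
  rw [hexp]
  calc (T.card * p ^ e) ^ 2 * (1 - p) = (T.card : ℝ) ^ 2 * (p ^ (2 * e) * (1 - p)) := by ring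
    _ ≤ (R.card * ∑ i ∈ T, ∑ j ∈ T, if r i = r j then (1 : ℝ) else 0)
        * (p ^ (2 * e) * (1 - p)) := by
        refine mul_le_mul_of_nonneg_right hpairs (mul_nonneg (pow_nonneg hp0 _) (by linarith))
    _ = R.card * ∑ i ∈ T, ∑ j ∈ T, if r i = r j then p ^ (2 * e) * (1 - p) else 0 := by
        rw [mul_assoc, Finset.sum_mul]
        simp_rw [Finset.sum_mul, ite_mul, one_mul, zero_mul]
    _ ≤ R.card * ∑ i ∈ T, ∑ j ∈ T, p ^ c * (p ^ (A i ∪ A j).card - p ^ (2 * e)) := by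
        gcongr with i hi j hj
        exact hterm i hi j hj
    _ = _ := by simp_rw [← Finset.mul_sum]; ring

end Moments

/-! ### Embeddings of a hypergraph into the complete `k`-graph -/

section Embeddings

variable {W : Type*} {k n : ℕ}

/-- The edges of the complete `k`-graph on `Fin n`. -/
abbrev KSubset (k n : ℕ) : Type := {f : Finset (Fin n) // f.card = k}

/-- The image of the edge set `E` under the vertex map `φ`. Images of edges that do not have `k`
elements are dropped; for injective `φ` and `k`-uniform `E` there are none. -/
def edgeImage (k : ℕ) (E : Finset (Finset W)) (φ : W → Fin n) : Finset (KSubset k n) :=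
  Finset.univ.filter fun f => ∃ e ∈ E, e.image φ = f.1

lemma mem_edgeImage {E : Finset (Finset W)} {φ : W → Fin n} {f : KSubset k n} :
    f ∈ edgeImage k E φ ↔ ∃ e ∈ E, e.image φ = f.1 := by simp [edgeImage]

lemma card_edgeImage {E : Finset (Finset W)} (hE : ∀ e ∈ E, e.card = k) {φ : W → Fin n}
    (hφ : Function.Injective φ) : (edgeImage k E φ).card = E.card := by
  rw [← Finset.card_image_of_injective E (Finset.image_injective hφ),
    ← Finset.card_image_of_injective (edgeImage k E φ) Subtype.val_injective]
  congr 1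
  ext f
  simp only [Finset.mem_image, mem_edgeImage]
  constructor
  · rintro ⟨g, ⟨e, he, h⟩, rfl⟩
    exact ⟨e, he, h⟩
  · rintro ⟨e, he, rfl⟩
    exact ⟨⟨e.image φ, (Finset.card_image_of_injective e hφ).trans (hE e he)⟩, ⟨e, he, rfl⟩, rfl⟩

/-- The edges of `E` that `φ` maps into `F`. -/
def preimageEdges (E : Finset (Finset W)) (F : Finset (KSubset k n)) (φ : W → Fin n) :
    Finset (Finset W) :=
  E.filter fun e => ∃ f ∈ F, e.image φ = f.1

lemma preimageEdges_nonempty {E : Finset (Finset W)} {φ : W → Fin n} {F : Finset (KSubset k n)}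
    (h : ¬ Disjoint (edgeImage k E φ) F) : (preimageEdges E F φ).Nonempty := by
  obtain ⟨f, hf, hfF⟩ := Finset.not_disjoint_iff.1 h
  obtain ⟨e, he, hef⟩ := mem_edgeImage.1 hf
  exact ⟨e, Finset.mem_filter.2 ⟨he, f, hfF, hef⟩⟩

variable [DecidableEq W]

/-- The vertices covered by the edge set `K`. -/
def cover (K : Finset (Finset W)) : Finset W := K.biUnion id

lemma card_edgeImage_sdiff {E : Finset (Finset W)} (hE : ∀ e ∈ E, e.card = k) {φ : W → Fin n}
    (hφ : Function.Injective φ) (F : Finset (KSubset k n)) :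
    (edgeImage k E φ \ F).card + (preimageEdges E F φ).card = E.card := by
  have h : edgeImage k E φ \ F = edgeImage k (E \ preimageEdges E F φ) φ := by
    ext f
    simp only [Finset.mem_sdiff, mem_edgeImage, preimageEdges, Finset.mem_filter, not_and,
      not_exists]
    constructor
    · rintro ⟨⟨e, he, h⟩, hf⟩
      refine ⟨e, ⟨he, fun _ g hg hgf => hf ?_⟩, h⟩
      rwa [Subtype.ext (h.symm.trans hgf)]
    · rintro ⟨e, ⟨he, h1⟩, h⟩
      exact ⟨⟨e, he, h⟩, fun hf => h1 he f hf h⟩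
  rw [h, card_edgeImage (fun e he => hE e (Finset.mem_sdiff.1 he).1) hφ]
  exact Finset.card_sdiff_add_card_eq_card (Finset.filter_subset _ _)

variable [Fintype W]

/-- The injective vertex maps that send each vertex `w` into `B w`. -/
def blockMaps (B : W → Finset (Fin n)) : Finset (W → Fin n) :=
  (Fintype.piFinset B).filter Function.Injective

lemma mem_blockMaps {B : W → Finset (Fin n)} {φ : W → Fin n} :
    φ ∈ blockMaps B ↔ (∀ w, φ w ∈ B w) ∧ Function.Injective φ := by
  simp [blockMaps]

lemma card_blockMaps_le (B : W → Finset (Fin n)) :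
    ((blockMaps B).card : ℝ) ≤ ∏ w, ((B w).card : ℝ) := by
  calc ((blockMaps B).card : ℝ) ≤ (Fintype.piFinset B).card := by
        exact_mod_cast Finset.card_filter_le _ _
    _ = _ := by rw [Fintype.card_piFinset]; push_cast; rfl

/-- Most maps are injective, by the union bound over all pairs of vertices. -/
lemma prod_card_le_two_mul_card_blockMaps (B : W → Finset (Fin n))
    (hB : ∀ w, 2 * Fintype.card W ^ 2 ≤ (B w).card) :
    ∏ w, ((B w).card : ℝ) ≤ 2 * (blockMaps B).card := by
  set v := Fintype.card W with hv
  rcases Nat.eq_zero_or_pos v with h0 | hpos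
  · have : IsEmpty W := Fintype.card_eq_zero_iff.1 (hv.symm.trans h0)
    have h1 : (blockMaps B).card = 1 := by
      refine Finset.card_eq_one.2 ⟨isEmptyElim, ?_⟩
      ext φ
      simp only [mem_blockMaps, Finset.mem_singleton]
      exact ⟨fun _ => Subsingleton.elim _ _, fun _ => ⟨isEmptyElim, fun a => isEmptyElim a⟩⟩
    rw [h1]; simp
  -- For each pair `w ≠ w'`, resampling the value at `w` shows that at most a fraction
  -- `1 / (2 * v ^ 2)` of all maps identify `w` and `w'`.
  set bad : W × W → Finset (W → Fin n) := fun x =>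
    (Fintype.piFinset B).filter fun φ => φ x.1 = φ x.2 with hbad
  set P := (Fintype.piFinset B).card with hP
  have hbadle : ∀ x ∈ (Finset.univ : Finset W).offDiag, 2 * v ^ 2 * (bad x).card ≤ P := by
    rintro ⟨w, w'⟩ hx
    have hne : w ≠ w' := by simpa using hx
    calc 2 * v ^ 2 * (bad (w, w')).card ≤ (B w).card * (bad (w, w')).card :=
          Nat.mul_le_mul_right _ (hB w)
      _ = (B w ×ˢ bad (w, w')).card := (Finset.card_product _ _).symm
      _ ≤ P := by
          refine Finset.card_le_card_of_injOn (fun y => Function.update y.2 w y.1) ?_ ?_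
          · rintro ⟨a, φ⟩ h
            simp only [hbad, Finset.coe_product, Set.mem_prod, Finset.mem_coe, Finset.mem_filter,
              Fintype.mem_piFinset] at h ⊢
            intro u
            by_cases hu : u = w
            · subst hu; simpa using h.1
            · rw [Function.update_of_ne hu]; exact h.2.1 u
          · rintro ⟨a, φ⟩ h ⟨a', φ'⟩ h' heq
            simp only [hbad, Finset.coe_product, Set.mem_prod, Finset.mem_coe, Finset.mem_filter,
              Fintype.mem_piFinset] at h h' heq
            have hu : ∀ u, u ≠ w → φ u = φ' u := fun u hu => by
              have := congrFun heq u
              rwa [Function.update_of_ne hu, Function.update_of_ne hu] at this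
            have ha : a = a' := by simpa using congrFun heq w
            refine Prod.ext ha (funext fun u => ?_)
            by_cases huw : u = w
            · subst huw
              exact h.2.2.trans ((hu w' hne.symm).trans h'.2.2.symm)
            · exact hu u huw
  have hcover : P ≤ (blockMaps B).card + ∑ x ∈ (Finset.univ : Finset W).offDiag, (bad x).card := by
    calc P ≤ (blockMaps B ∪ (Finset.univ : Finset W).offDiag.biUnion bad).card := by
          refine Finset.card_le_card fun φ hφ => ?_
          by_cases h : Function.Injective φ
          · exact Finset.mem_union_left _ (Finset.mem_filter.2 ⟨hφ, h⟩)
          · refine Finset.mem_union_right _ (Finset.mem_biUnion.2 ?_)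
            simp only [Function.Injective, not_forall] at h
            obtain ⟨a, b, hab, hne⟩ := h
            exact ⟨(a, b), by simpa using hne, Finset.mem_filter.2 ⟨hφ, hab⟩⟩
      _ ≤ _ := (Finset.card_union_le _ _).trans (Nat.add_le_add_left Finset.card_biUnion_le _)
  have hsum : 2 * v ^ 2 * ∑ x ∈ (Finset.univ : Finset W).offDiag, (bad x).card ≤ v ^ 2 * P := by
    rw [Finset.mul_sum]
    refine (Finset.sum_le_card_nsmul _ _ _ hbadle).trans ?_
    rw [smul_eq_mul]
    refine Nat.mul_le_mul_right _ ?_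
    rw [Finset.offDiag_card, Finset.card_univ, sq]
    exact Nat.sub_le _ _
  have hsum' : 2 * ∑ x ∈ (Finset.univ : Finset W).offDiag, (bad x).card ≤ P := by
    have : 0 < v ^ 2 := by positivity
    refine Nat.le_of_mul_le_mul_left ?_ this
    linarith
  have hfin : P ≤ 2 * (blockMaps B).card := by omega
  have hPr : (P : ℝ) = ∏ w, ((B w).card : ℝ) := by
    rw [hP, Fintype.card_piFinset]; push_cast; rfl
  rw [← hPr]
  exact_mod_cast hfin

/-- The weighted number of embeddings in a block, given that the edges of `F` are present. The
embeddings are classified by the set `K` of edges that they map into `F`: the vertices covered by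
`K` have at most `s` possible images each, and the other vertices and edges contribute the expected
number of embeddings divided by that of `K`, hence at most a fraction `1 / Φ` of the former. -/
lemma sum_pow_card_edgeImage_sdiff_le {p : ℝ} (hp0 : 0 ≤ p) {E : Finset (Finset W)}
    (hE : ∀ e ∈ E, e.card = k) (B : W → Finset (Fin n)) (F : Finset (KSubset k n)) {s : ℕ}
    (hs : k * F.card + 1 ≤ s) {Φ : ℝ} (hΦ : 0 < Φ) (T : Finset (W → Fin n)) (hT : T ⊆ blockMaps B)
    (hK : ∀ φ ∈ T, Φ ≤ (∏ w ∈ cover (preimageEdges E F φ), ((B w).card : ℝ))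
      * p ^ (preimageEdges E F φ).card) :
    ∑ φ ∈ T, p ^ (edgeImage k E φ \ F).card
      ≤ 2 ^ E.card * (s : ℝ) ^ Fintype.card W * ((∏ w, ((B w).card : ℝ)) * p ^ E.card) / Φ := by
  obtain ⟨M, hM⟩ : ∃ M, M = (∏ w, ((B w).card : ℝ)) * p ^ E.card := ⟨_, rfl⟩
  rw [← hM]
  have hB0 : ∀ U : Finset W, 0 ≤ ∏ w ∈ U, ((B w).card : ℝ) := fun U =>
    Finset.prod_nonneg fun w _ => Nat.cast_nonneg _
  have hM0 : 0 ≤ M := hM ▸ mul_nonneg (hB0 _) (pow_nonneg hp0 _)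
  have hs1 : (1 : ℝ) ≤ s := Nat.one_le_cast.2 ((Nat.le_add_left 1 _).trans hs)
  set VF : Finset (Fin n) := F.biUnion Subtype.val
  have hVF : VF.card ≤ s := by
    calc VF.card ≤ ∑ f ∈ F, f.1.card := Finset.card_biUnion_le
      _ = k * F.card := by
          rw [Finset.sum_congr rfl fun f _ => f.2, Finset.sum_const, smul_eq_mul, mul_comm]
      _ ≤ s := by omega
  have hfib : ∀ K ∈ E.powerset, ∑ φ ∈ T with preimageEdges E F φ = K,
      p ^ (edgeImage k E φ \ F).card ≤ (s : ℝ) ^ Fintype.card W * M / Φ := by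
    intro K hKE
    rw [Finset.mem_powerset] at hKE
    rcases (T.filter fun φ => preimageEdges E F φ = K).eq_empty_or_nonempty with h | ⟨φ₀, hφ₀⟩
    · rw [h, Finset.sum_empty]
      exact div_nonneg (mul_nonneg (pow_nonneg (zero_le_one.trans hs1) _) hM0) hΦ.le
    have hΦK : Φ ≤ (∏ w ∈ cover K, ((B w).card : ℝ)) * p ^ K.card := by
      rw [Finset.mem_filter] at hφ₀
      have := hK φ₀ hφ₀.1
      rwa [hφ₀.2] at this
    have hterm : ∀ φ ∈ T.filter (fun φ => preimageEdges E F φ = K),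
        p ^ (edgeImage k E φ \ F).card = p ^ (E.card - K.card) := by
      intro φ hφ
      rw [Finset.mem_filter] at hφ
      have := card_edgeImage_sdiff hE (mem_blockMaps.1 (hT hφ.1)).2 F
      rw [hφ.2] at this
      congr 1
      omega
    have hcount : ((T.filter fun φ => preimageEdges E F φ = K).card : ℝ)
        ≤ (s : ℝ) ^ Fintype.card W * ∏ w ∈ (cover K)ᶜ, ((B w).card : ℝ) := by
      have hsub : T.filter (fun φ => preimageEdges E F φ = K)
          ⊆ Fintype.piFinset fun w => if w ∈ cover K then VF else B w := by
        intro φ hφ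
        rw [Finset.mem_filter] at hφ
        rw [Fintype.mem_piFinset]
        intro w
        split_ifs with hw
        · obtain ⟨e, he, hwe⟩ := Finset.mem_biUnion.1 hw
          rw [← hφ.2] at he
          obtain ⟨f, hf, hef⟩ := (Finset.mem_filter.1 he).2
          refine Finset.mem_biUnion.2 ⟨f, hf, ?_⟩
          rw [← hef]
          exact Finset.mem_image_of_mem φ hwe
        · exact (mem_blockMaps.1 (hT hφ.1)).1 w
      calc _ ≤ ((Fintype.piFinset fun w => if w ∈ cover K then VF else B w).card : ℝ) := by
            exact_mod_cast Finset.card_le_card hsub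
        _ = ∏ w, (((if w ∈ cover K then VF else B w).card : ℕ) : ℝ) := by
            rw [Fintype.card_piFinset]; push_cast; rfl
        _ = (∏ w ∈ cover K, (VF.card : ℝ)) * ∏ w ∈ (cover K)ᶜ, ((B w).card : ℝ) := by
            rw [← Finset.prod_mul_prod_compl (cover K)]
            congr 1
            · exact Finset.prod_congr rfl fun w hw => by rw [if_pos hw]
            · exact Finset.prod_congr rfl fun w hw => by rw [if_neg (Finset.mem_compl.1 hw)]
        _ ≤ _ := by
            refine mul_le_mul_of_nonneg_right ?_ (hB0 _)
            rw [Finset.prod_const]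
            calc (VF.card : ℝ) ^ (cover K).card ≤ (s : ℝ) ^ (cover K).card := by
                  gcongr
              _ ≤ _ := pow_le_pow_right₀ hs1 (Finset.card_le_univ _)
    rw [Finset.sum_congr rfl hterm, Finset.sum_const, nsmul_eq_mul, le_div_iff₀ hΦ]
    calc _ ≤ ((s : ℝ) ^ Fintype.card W * ∏ w ∈ (cover K)ᶜ, ((B w).card : ℝ))
          * p ^ (E.card - K.card) * ((∏ w ∈ cover K, ((B w).card : ℝ)) * p ^ K.card) := by gcongr
      _ = (s : ℝ) ^ Fintype.card W * ((∏ w ∈ cover K, ((B w).card : ℝ)) *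
          (∏ w ∈ (cover K)ᶜ, ((B w).card : ℝ)) * (p ^ K.card * p ^ (E.card - K.card))) := by ring
      _ = _ := by
          rw [hM, Finset.prod_mul_prod_compl, ← pow_add,
            Nat.add_sub_of_le (Finset.card_le_card hKE)]
  rw [← Finset.sum_fiberwise_of_maps_to (t := E.powerset) (g := preimageEdges E F)
    fun φ _ => Finset.mem_powerset.2 (Finset.filter_subset _ _)]
  refine (Finset.sum_le_card_nsmul _ _ _ hfib).trans (le_of_eq ?_)
  rw [Finset.card_powerset, nsmul_eq_mul]
  push_cast
  ring

end Embeddings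

/-! ### The number of embeddings in a block -/

section Block

variable {W : Type*} [DecidableEq W] [Fintype W] {k n : ℕ} {p : ℝ}

/-- A constant depending only on the numbers `v` of vertices and `e` of edges of a `k`-graph. It
bounds the number of ways in which an embedding can meet the image of at most three others. -/
noncomputable def overlapConst (k e v : ℕ) : ℝ := 2 ^ e * ((k * (3 * e) + 1 : ℕ) : ℝ) ^ v

lemma overlapConst_pos (k e v : ℕ) : 0 < overlapConst k e v := by
  unfold overlapConst; positivity

/-- The `p`-weighted number of maps that send `w` into `B w` for all vertices `w` covered by `K`; up
to a constant factor, the expected number of copies of `K` in the block `B`. -/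
noncomputable def blockMean (p : ℝ) (B : W → Finset (Fin n)) (K : Finset (Finset W)) : ℝ :=
  (∏ w ∈ cover K, ((B w).card : ℝ)) * p ^ K.card

variable {E : Finset (Finset W)} {B : W → Finset (Fin n)} {F : Finset (KSubset k n)} {Φ : ℝ}

lemma sum_not_disjoint_le (hp0 : 0 ≤ p) (hE : ∀ e ∈ E, e.card = k) (hF : F.card ≤ 3 * E.card)
    (hΦ : 0 < Φ) (hmin : ∀ K ⊆ E, K.Nonempty → Φ ≤ blockMean p B K) :
    ∑ φ ∈ blockMaps B with ¬ Disjoint (edgeImage k E φ) F, p ^ (edgeImage k E φ \ F).card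
      ≤ overlapConst k E.card (Fintype.card W) * ((∏ w, ((B w).card : ℝ)) * p ^ E.card) / Φ :=
  sum_pow_card_edgeImage_sdiff_le hp0 hE B F (Nat.succ_le_succ (Nat.mul_le_mul_left k hF)) hΦ _
    (Finset.filter_subset _ _) fun _ hφ => hmin _ (Finset.filter_subset _ _)
      (preimageEdges_nonempty (Finset.mem_filter.1 hφ).2)

lemma sum_blockMaps_le (hp0 : 0 ≤ p) (hE : ∀ e ∈ E, e.card = k) (hF : F.card ≤ 3 * E.card)
    (hmin : ∀ K ⊆ E, K.Nonempty → 1 ≤ blockMean p B K) :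
    ∑ φ ∈ blockMaps B, p ^ (edgeImage k E φ \ F).card
      ≤ overlapConst k E.card (Fintype.card W) * ((∏ w, ((B w).card : ℝ)) * p ^ E.card) := by
  rw [← div_one (overlapConst _ _ _ * _)]
  refine sum_pow_card_edgeImage_sdiff_le hp0 hE B F (Nat.succ_le_succ (Nat.mul_le_mul_left k hF))
    one_pos _ subset_rfl fun φ _ => ?_
  rcases (preimageEdges E F φ).eq_empty_or_nonempty with h | h
  · simp [h, cover]
  · exact hmin _ (Finset.filter_subset _ _) h

/-- The variance proxy `Λ` in Janson's inequality for the number of embeddings in a block. -/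
lemma sum_sum_not_disjoint_le (hp0 : 0 ≤ p) (hE : ∀ e ∈ E, e.card = k)
    (hΦ : 0 < Φ) (hmin : ∀ K ⊆ E, K.Nonempty → Φ ≤ blockMean p B K) :
    ∑ φ ∈ blockMaps B, ∑ ψ ∈ blockMaps B with ¬ Disjoint (edgeImage k E φ) (edgeImage k E ψ),
      p ^ (edgeImage k E φ ∪ edgeImage k E ψ).card
      ≤ (blockMaps B).card * p ^ E.card * (overlapConst k E.card (Fintype.card W)
        * ((∏ w, ((B w).card : ℝ)) * p ^ E.card) / Φ) := by
  have h : ∀ φ ∈ blockMaps B,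
      ∑ ψ ∈ blockMaps B with ¬ Disjoint (edgeImage k E φ) (edgeImage k E ψ),
        p ^ (edgeImage k E φ ∪ edgeImage k E ψ).card ≤ p ^ E.card *
        (overlapConst k E.card (Fintype.card W)
          * ((∏ w, ((B w).card : ℝ)) * p ^ E.card) / Φ) := by
    intro φ hφ
    have hcard := card_edgeImage hE (mem_blockMaps.1 hφ).2
    have := sum_not_disjoint_le (F := edgeImage k E φ) hp0 hE (by omega) hΦ hmin
    refine le_trans (le_of_eq ?_) (mul_le_mul_of_nonneg_left this (pow_nonneg hp0 _))
    rw [Finset.mul_sum]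
    simp only [disjoint_comm]
    refine Finset.sum_congr rfl fun ψ _ => ?_
    rw [← hcard, ← pow_add, ← Finset.union_sdiff_self_eq_union,
      Finset.card_union_of_disjoint Finset.disjoint_sdiff]
  refine (Finset.sum_le_sum h).trans (le_of_eq ?_)
  rw [Finset.sum_const, nsmul_eq_mul]
  ring

lemma expect_embeddings_pow_four_le (hp0 : 0 ≤ p) (hp1 : p ≤ 1) (hE : ∀ e ∈ E, e.card = k)
    (hB : ∀ w, 2 * Fintype.card W ^ 2 ≤ (B w).card)
    (hΦ : 1 ≤ Φ) (hmin : ∀ K ⊆ E, K.Nonempty → Φ ≤ blockMean p B K) :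
    expect p (fun S => (∑ φ ∈ blockMaps B, (ind (edgeImage k E φ) S - p ^ E.card)) ^ 4)
      ≤ 384 * overlapConst k E.card (Fintype.card W) ^ 3 * ((blockMaps B).card * p ^ E.card) ^ 4
        / Φ ^ 2 := by
  set C := overlapConst k E.card (Fintype.card W) with hC
  have hC0 : 0 < C := overlapConst_pos _ _ _
  have hM0 : 0 ≤ (∏ w, ((B w).card : ℝ)) * p ^ E.card :=
    mul_nonneg (Finset.prod_nonneg fun w _ => Nat.cast_nonneg _) (pow_nonneg hp0 _)
  have hMμ : (∏ w, ((B w).card : ℝ)) * p ^ E.card ≤ 2 * ((blockMaps B).card * p ^ E.card) := by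
    rw [← mul_assoc]
    exact mul_le_mul_of_nonneg_right (prod_card_le_two_mul_card_blockMaps B hB) (pow_nonneg hp0 _)
  have hcard : ∀ φ ∈ blockMaps B, (edgeImage k E φ).card = E.card := fun φ hφ =>
    card_edgeImage hE (mem_blockMaps.1 hφ).2
  have hΦ0 : 0 < Φ := by linarith
  have h := expect_sum_centered_pow_four_le (q := p ^ E.card) hp0 hp1 (blockMaps B) (edgeImage k E)
    (fun φ hφ => by rw [hcard φ hφ]) (mul_nonneg hC0.le hM0)
    (div_nonneg (mul_nonneg hC0.le hM0) hΦ0.le)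
    (fun i hi j hj => sum_blockMaps_le hp0 hE
      ((Finset.card_union_le _ _).trans (by have := hcard i hi; have := hcard j hj; omega))
      fun K hK hK' => hΦ.trans (hmin K hK hK'))
    (fun i hi j hj l hl => sum_not_disjoint_le hp0 hE
      ((Finset.card_union_le _ _).trans ((Nat.add_le_add_right (Finset.card_union_le _ _) _).trans
        (by have := hcard i hi; have := hcard j hj; have := hcard l hl; omega))) hΦ0 hmin)
  refine h.trans ?_
  generalize (∏ w, ((B w).card : ℝ)) * p ^ E.card = M at *
  have hμ0 : 0 ≤ ((blockMaps B).card : ℝ) * p ^ E.card := by positivity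
  generalize ((blockMaps B).card : ℝ) * p ^ E.card = μ at *
  have h3 : M ^ 3 ≤ (2 * μ) ^ 3 := by gcongr
  calc 48 * μ * (C * M) * (C * M / Φ) ^ 2 = 48 * μ * C ^ 3 / Φ ^ 2 * M ^ 3 := by ring
    _ ≤ 48 * μ * C ^ 3 / Φ ^ 2 * (2 * μ) ^ 3 := by gcongr
    _ = _ := by ring

/-- Two embeddings that agree on the vertices covered by `K₀` share the edges in the image of `K₀`,
so such pairs alone contribute the right order of magnitude to the variance. -/
lemma le_expect_embeddings_sq (hp0 : 0 ≤ p) (hp1 : p ≤ 1) (hE : ∀ e ∈ E, e.card = k)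
    {K₀ : Finset (Finset W)} (hK₀ : K₀ ⊆ E) (hne : K₀.Nonempty) :
    ((blockMaps B).card * p ^ E.card) ^ 2 * (1 - p) ≤ blockMean p B K₀ *
      expect p (fun S => (∑ φ ∈ blockMaps B, (ind (edgeImage k E φ) S - p ^ E.card)) ^ 2) := by
  have h := le_expect_sum_centered_sq hp0 hp1 (blockMaps B) (edgeImage k E) (e := E.card)
    (fun φ hφ => card_edgeImage hE (mem_blockMaps.1 hφ).2) hne.card_pos
    (fun φ (w : {w // w ∈ cover K₀}) => φ w)
    (Fintype.piFinset fun w : {w // w ∈ cover K₀} => B w)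
    (fun φ hφ => Fintype.mem_piFinset.2 fun w => (mem_blockMaps.1 hφ).1 w) ?_
  · refine h.trans (le_of_eq ?_)
    rw [blockMean, Fintype.card_piFinset]
    push_cast
    rw [Finset.prod_coe_sort (cover K₀) fun w => ((B w).card : ℝ)]
  · intro φ hφ ψ hψ h
    rw [← card_edgeImage (fun e he => hE e (hK₀ he)) (mem_blockMaps.1 hφ).2]
    refine Finset.card_le_card fun f hf => ?_
    obtain ⟨e, he, hef⟩ := mem_edgeImage.1 hf
    refine Finset.mem_inter.2 ⟨mem_edgeImage.2 ⟨e, hK₀ he, hef⟩,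
      mem_edgeImage.2 ⟨e, hK₀ he, ?_⟩⟩
    rw [← hef]
    refine Finset.image_congr fun w hw => ?_
    exact (congrFun h ⟨w, Finset.mem_biUnion.2 ⟨e, he, hw⟩⟩).symm

/-- In a block whose expected subgraph counts are all at least `Φ`, and in which `Φ` is at most
of the order of `(1 - p) ^ 3 / ε ^ 2`, the number of embeddings falls short of its mean by the
factor `1 - ε` with probability at least of the order of `(1 - p) ^ 2`. -/
theorem le_prob_block (hp0 : 0 < p) (hp1 : p < 1) (hE : ∀ e ∈ E, e.card = k)
    {K₀ : Finset (Finset W)} (hK₀ : K₀ ⊆ E) (hne : K₀.Nonempty)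
    (hB : ∀ w, 2 * Fintype.card W ^ 2 ≤ (B w).card) {G ε L : ℝ} (hΦ : 1 ≤ Φ) (hG : 0 < G)
    (hε : 0 ≤ ε) (hL : L = 128 * (384 * overlapConst k E.card (Fintype.card W) ^ 3))
    (hmin : ∀ K ⊆ E, K.Nonempty → Φ ≤ blockMean p B K) (hmax : blockMean p B K₀ ≤ G * Φ)
    (hεΦ : ε ^ 2 * (L * G ^ 3 * Φ) ≤ (1 - p) ^ 3) :
    (1 - p) ^ 2 / (L * G ^ 2) ≤ prob p {S | ∑ φ ∈ blockMaps B, ind (edgeImage k E φ) S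
      ≤ (1 - ε) * ((blockMaps B).card * p ^ E.card)} := by
  set Y : Finset (KSubset k n) → ℝ :=
    fun S => ∑ φ ∈ blockMaps B, (ind (edgeImage k E φ) S - p ^ E.card) with hY
  have hC0 := overlapConst_pos k E.card (Fintype.card W)
  have hvar := le_expect_embeddings_sq (B := B) hp0.le hp1.le hE hK₀ hne
  have hfour := expect_embeddings_pow_four_le hp0.le hp1.le hE hB hΦ hmin
  have hmean := expect_sum_centered (p := p) (blockMaps B) (edgeImage k E) (q := p ^ E.card)
    fun φ hφ => by rw [card_edgeImage hE (mem_blockMaps.1 hφ).2]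
  have hμ : 0 < ((blockMaps B).card : ℝ) * p ^ E.card := by
    have h1 := prod_card_le_two_mul_card_blockMaps B hB
    have h2 : 0 < ∏ w, ((B w).card : ℝ) := Finset.prod_pos fun w _ => by
      have : 0 < Fintype.card W := Fintype.card_pos_iff.2 ⟨w⟩
      have h3 : 0 < 2 * Fintype.card W ^ 2 := by positivity
      exact_mod_cast h3.trans_le (hB w)
    have h3 : 0 < ((blockMaps B).card : ℝ) := by linarith
    positivity
  have hset : {S | ∑ φ ∈ blockMaps B, ind (edgeImage k E φ) S
      ≤ (1 - ε) * ((blockMaps B).card * p ^ E.card)}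
      = {S | Y S ≤ -(ε * ((blockMaps B).card * p ^ E.card))} := by
    ext S
    simp only [hY, Set.mem_ofPred_eq, Finset.sum_sub_distrib, Finset.sum_const, nsmul_eq_mul]
    constructor <;> intro h <;> linarith
  rw [hset]
  have hΦ0 : 0 < Φ := by linarith
  set x := expect p (fun S => Y S ^ 2) with hx
  have hq : 0 < 1 - p := by linarith
  generalize overlapConst k E.card (Fintype.card W) = C at *
  generalize ((blockMaps B).card : ℝ) * p ^ E.card = μ at *
  have hL0 : 0 < L := by rw [hL]; positivity
  have hxle : μ ^ 2 * (1 - p) / (G * Φ) ≤ x := by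
    rw [div_le_iff₀ (by positivity)]
    have hx0 : 0 ≤ x := expect_nonneg hp0.le hp1.le fun S => sq_nonneg _
    calc _ ≤ blockMean p B K₀ * x := hvar
      _ ≤ G * Φ * x := by gcongr
      _ = _ := by ring
  have hx0 : 0 < μ ^ 2 * (1 - p) / (G * Φ) := by positivity
  have h := le_prob_le_neg hp0.le hp1.le Y (t := ε * μ) hmean (hx0.trans_le hxle) hfour
    (by positivity) ?_
  · refine le_trans ?_ h
    calc (1 - p) ^ 2 / (L * G ^ 2)
        = (μ ^ 2 * (1 - p) / (G * Φ)) ^ 2 / (128 * (384 * C ^ 3 * μ ^ 4 / Φ ^ 2)) := by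
          rw [hL]; field_simp
      _ ≤ _ := by gcongr
  · refine le_trans ?_ (pow_le_pow_left₀ hx0.le hxle 3)
    calc (ε * μ) ^ 2 * (128 * (384 * C ^ 3 * μ ^ 4 / Φ ^ 2))
        = ε ^ 2 * (L * G ^ 3 * Φ) * (μ ^ 6 / (G ^ 3 * Φ ^ 3)) := by
          rw [hL]; field_simp
      _ ≤ (1 - p) ^ 3 * (μ ^ 6 / (G ^ 3 * Φ ^ 3)) := by gcongr
      _ = _ := by field_simp

end Block

/-! ### Tail bounds for the number of embeddings -/

section Tails

variable {W : Type*} [DecidableEq W] {k n : ℕ} {p : ℝ}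

/-- The block that does not restrict the images of the vertices. -/
abbrev fullBlock (W : Type*) (n : ℕ) : W → Finset (Fin n) := fun _ => Finset.univ

lemma blockMean_fullBlock (K : Finset (Finset W)) :
    blockMean p (fullBlock W n) K = (n : ℝ) ^ (cover K).card * p ^ K.card := by
  simp [blockMean]

variable [Fintype W]

/-- The number of injective maps from `W` to `Fin n` that send all edges in `E` to elements
of `S`. -/
noncomputable def embCount (E : Finset (Finset W)) (S : Finset (KSubset k n)) : ℝ :=
  ∑ φ ∈ blockMaps (fullBlock W n), ind (edgeImage k E φ) S

variable {E K₀ : Finset (Finset W)}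

/-- The upper bound on the lower tail of the number of embeddings: Janson's inequality, with a
variance proxy of at most a constant times the squared mean divided by `Ψ`. -/
lemma upper_bound_embCount (hp0 : 0 < p) (hp1 : p ≤ 1) (hE : ∀ e ∈ E, e.card = k)
    (hn : 2 * Fintype.card W ^ 2 ≤ n) (hn0 : 0 < n) {Ψ ε : ℝ} (hΨ : 0 < Ψ) (hε : 0 ≤ ε)
    (hmin : ∀ K ⊆ E, K.Nonempty → Ψ ≤ blockMean p (fullBlock W n) K) :
    prob p {S : Finset (KSubset k n) | embCount E S
        ≤ (1 - ε) * ((blockMaps (fullBlock W n)).card * p ^ E.card)}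
      ≤ Real.exp (-((4 * overlapConst k E.card (Fintype.card W))⁻¹ * ε ^ 2 * Ψ)) := by
  have hsum := sum_sum_not_disjoint_le (B := fullBlock W n) hp0.le hE hΨ hmin
  have hM := prod_card_le_two_mul_card_blockMaps (fullBlock W n) fun w => by simpa using hn
  have hC0 := overlapConst_pos k E.card (Fintype.card W)
  have hμsum : ∑ φ ∈ blockMaps (fullBlock W n), p ^ (edgeImage k E φ).card
      = (blockMaps (fullBlock W n)).card * p ^ E.card := by
    rw [Finset.sum_congr rfl fun φ hφ => by rw [card_edgeImage hE (mem_blockMaps.1 hφ).2],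
      Finset.sum_const, nsmul_eq_mul]
  have hq : 0 < p ^ E.card := by positivity
  have hP0 : 0 < ∏ w : W, ((fullBlock W n w).card : ℝ) :=
    Finset.prod_pos fun w _ => by simpa using hn0
  have hT0 : 0 < ((blockMaps (fullBlock W n)).card : ℝ) := by linarith
  have hμ0 : 0 < ((blockMaps (fullBlock W n)).card : ℝ) * p ^ E.card := by positivity
  have hM' : (∏ w : W, ((fullBlock W n w).card : ℝ)) * p ^ E.card
      ≤ 2 * ((blockMaps (fullBlock W n)).card * p ^ E.card) := by
    rw [← mul_assoc]
    exact mul_le_mul_of_nonneg_right hM hq.le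
  have hM0' : 0 < (∏ w : W, ((fullBlock W n w).card : ℝ)) * p ^ E.card := by positivity
  have hset : {S : Finset (KSubset k n) | embCount E S
        ≤ (1 - ε) * ((blockMaps (fullBlock W n)).card * p ^ E.card)}
      = {S | ∑ φ ∈ blockMaps (fullBlock W n), ind (edgeImage k E φ) S
        ≤ ∑ φ ∈ blockMaps (fullBlock W n), p ^ (edgeImage k E φ).card
          - ε * ((blockMaps (fullBlock W n)).card * p ^ E.card)} := by
    rw [hμsum]
    ext S
    simp only [embCount, Set.mem_ofPred_eq]
    constructor <;> intro h <;> linarith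
  rw [hset]
  generalize (∏ w : W, ((fullBlock W n w).card : ℝ)) * p ^ E.card = M at *
  generalize ((blockMaps (fullBlock W n)).card : ℝ) * p ^ E.card = μ at *
  generalize overlapConst k E.card (Fintype.card W) = C at *
  have hΛ : ∑ φ ∈ blockMaps (fullBlock W n), ∑ ψ ∈ blockMaps (fullBlock W n) with
      ¬ Disjoint (edgeImage k E φ) (edgeImage k E ψ),
      p ^ (edgeImage k E φ ∪ edgeImage k E ψ).card ≤ 2 * C * μ ^ 2 / Ψ := by
    refine hsum.trans ?_
    calc μ * (C * M / Ψ) ≤ μ * (C * (2 * μ) / Ψ) := by gcongr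
      _ = _ := by ring
  refine (janson hp0 hp1 _ _ (by positivity) (by positivity) hΛ).trans (le_of_eq ?_)
  congr 2
  field_simp
  norm_num

/-- By Harris' inequality, the copies of a subgraph `K₀` are all absent with at least the
probability that they would have if they were independent. -/
lemma exp_le_prob_embCount_eq_zero (hp0 : 0 ≤ p) (hp1 : p < 1) (hE : ∀ e ∈ E, e.card = k)
    (hK₀ : K₀ ⊆ E) (hne : K₀.Nonempty) :
    Real.exp (-(blockMean p (fullBlock W n) K₀ / (1 - p)))
      ≤ prob p {S : Finset (KSubset k n) | embCount E S = 0} := by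
  -- The edge sets of the copies of `K₀`; such a copy is determined by the images of the vertices
  -- in `cover K₀`.
  set 𝒜 := (blockMaps (fullBlock W n)).image (edgeImage k K₀) with h𝒜
  set x := p ^ K₀.card with hx
  have hq : 0 < 1 - p := by linarith
  have hxp : x ≤ p := pow_le_of_le_one hp0 hp1.le hne.card_pos.ne'
  have hx0 : 0 ≤ x := pow_nonneg hp0 _
  have hcard : ∀ A ∈ 𝒜, A.card = K₀.card := by
    intro A hA
    obtain ⟨φ, hφ, rfl⟩ := Finset.mem_image.1 hA
    exact card_edgeImage (fun e he => hE e (hK₀ he)) (mem_blockMaps.1 hφ).2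
  have h𝒜card : 𝒜.card ≤ n ^ (cover K₀).card := by
    rcases 𝒜.eq_empty_or_nonempty with h0 | ⟨A₀, hA₀⟩
    · simp [h0]
    have : Nonempty (W → Fin n) := ⟨(Finset.mem_image.1 hA₀).choose⟩
    choose! s hs using fun A hA => Finset.mem_image.1 (show A ∈ 𝒜 from hA)
    calc 𝒜.card ≤ (Finset.univ : Finset ({w // w ∈ cover K₀} → Fin n)).card := by
          refine Finset.card_le_card_of_injOn (fun A w => s A w) (fun _ _ => Finset.mem_univ _) ?_
          intro A hA A' hA' heq
          rw [← (hs A hA).2, ← (hs A' hA').2]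
          ext f
          simp only [mem_edgeImage]
          refine exists_congr fun e => and_congr_right fun he => ?_
          have h : e.image (s A) = e.image (s A') := Finset.image_congr fun w hw =>
            congrFun heq ⟨w, Finset.mem_biUnion.2 ⟨e, he, hw⟩⟩
          rw [h]
      _ = n ^ (cover K₀).card := by simp
  have hD : ∀ A ∈ 𝒜, Real.exp (-(x / (1 - p))) ≤ prob p {S : Finset (KSubset k n) | ¬ A ⊆ S} := by
    intro A hA
    have h1 : prob p {S : Finset (KSubset k n) | ¬ A ⊆ S} = 1 - x := by
      have e : Set.indicator {S : Finset (KSubset k n) | ¬ A ⊆ S} (1 : Finset (KSubset k n) → ℝ)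
          = fun S => 1 - ind A S := by
        ext S
        by_cases h : A ⊆ S <;> simp [ind, h]
      rw [prob, e, expect_sub, expect_const, expect_ind, hcard A hA]
    rw [h1, Real.exp_neg, inv_le_comm₀ (Real.exp_pos _) (by linarith)]
    calc (1 - x)⁻¹ = x / (1 - x) + 1 := by
          have : (1 - x) ≠ 0 := by linarith
          field_simp; ring
      _ ≤ x / (1 - p) + 1 := by gcongr
      _ ≤ _ := Real.add_one_le_exp _
  have hharris := prod_prob_le_prob_iInter (p := p) hp0 hp1.le 𝒜
    (fun A => {S : Finset (KSubset k n) | ¬ A ⊆ S}) fun A _ S S' h hS hA => hS (hA.trans h)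
  calc Real.exp (-(blockMean p (fullBlock W n) K₀ / (1 - p)))
      ≤ Real.exp (-(x / (1 - p))) ^ 𝒜.card := by
        rw [← Real.exp_nat_mul, blockMean_fullBlock]
        refine Real.exp_le_exp.2 ?_
        have h1 : (𝒜.card : ℝ) ≤ (n : ℝ) ^ (cover K₀).card := by exact_mod_cast h𝒜card
        have h2 : 0 ≤ x / (1 - p) := by positivity
        have h3 := mul_le_mul_of_nonneg_right h1 h2
        rw [mul_div_assoc]
        linarith
    _ = ∏ A ∈ 𝒜, Real.exp (-(x / (1 - p))) := by rw [Finset.prod_const]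
    _ ≤ ∏ A ∈ 𝒜, prob p {S : Finset (KSubset k n) | ¬ A ⊆ S} :=
        Finset.prod_le_prod (fun _ _ => (Real.exp_pos _).le) hD
    _ ≤ _ := hharris
    _ ≤ _ := by
        refine prob_mono hp0 hp1.le fun S hS => Finset.sum_eq_zero fun φ hφ => if_neg fun hsub => ?_
        refine hS _ (Finset.mem_image_of_mem _ hφ) (Finset.Subset.trans (fun f hf => ?_) hsub)
        obtain ⟨e, he, hef⟩ := mem_edgeImage.1 hf
        exact mem_edgeImage.2 ⟨e, hK₀ he, hef⟩

/-- The residue class of `i` modulo `b`, as a subset of `Fin n`. -/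
def residueClass (n : ℕ) {b : ℕ} (i : Fin b) : Finset (Fin n) :=
  Finset.univ.filter fun x => (x : ℕ) % b = i

lemma le_card_residueClass {b : ℕ} (i : Fin b) (hbn : b ≤ n) :
    n ≤ 2 * b * (residueClass n i).card := by
  have hb : 0 < b := i.pos
  have h1 : n / b ≤ (residueClass n i).card := by
    rw [← Finset.card_range (n / b)]
    have hlt : ∀ j ∈ Finset.range (n / b), j * b + i < n := by
      intro j hj
      have h2 : j + 1 ≤ n / b := Finset.mem_range.1 hj
      have h3 : (j + 1) * b ≤ n := (Nat.mul_le_mul_right b h2).trans (Nat.div_mul_le_self n b)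
      have := i.2
      nlinarith
    refine Finset.card_le_card_of_forall_subsingleton
      (fun j (x : Fin n) => (x : ℕ) = j * b + i) ?_ ?_
    · intro j hj
      refine ⟨⟨j * b + i, hlt j hj⟩, ?_, rfl⟩
      simp [residueClass, Nat.mod_eq_of_lt i.2]
    · intro x _ j hj j' hj'
      have : j * b + i = j' * b + i := hj.2.symm.trans hj'.2
      exact Nat.eq_of_mul_eq_mul_right hb (by omega)
  have h4 : 1 ≤ n / b := Nat.div_pos hbn hb
  have h5 : n < b * (n / b + 1) := Nat.lt_mul_div_succ n hb
  nlinarith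

lemma card_residueClass_le {b : ℕ} (i : Fin b) (hbn : b ≤ n) :
    b * (residueClass n i).card ≤ 2 * n := by
  have hb : 0 < b := i.pos
  have h1 : (residueClass n i).card ≤ n / b + 1 := by
    rw [← Finset.card_range (n / b + 1)]
    refine Finset.card_le_card_of_injOn (fun x => (x : ℕ) / b) ?_ ?_
    · intro x _
      have : (x : ℕ) / b ≤ n / b := Nat.div_le_div_right x.2.le
      simpa using Nat.lt_succ_of_le this
    · intro x hx y hy h
      simp only [residueClass, Finset.coe_filter, Finset.mem_univ, true_and,
        Set.mem_ofPred_eq] at hx hy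
      refine Fin.ext ?_
      rw [← Nat.div_add_mod (x : ℕ) b, ← Nat.div_add_mod (y : ℕ) b, hx, hy]
      simp only at h
      rw [h]
  have h2 : n / b * b ≤ n := Nat.div_mul_le_self n b
  nlinarith

/-- The block of the vertex maps that send each vertex `w` covered by `K₀` into the residue class
`β w` modulo `b`. -/
def residueBlock (n : ℕ) {b : ℕ} (K₀ : Finset (Finset W)) (β : {w // w ∈ cover K₀} → Fin b) :
    W → Finset (Fin n) :=
  fun w => if h : w ∈ cover K₀ then residueClass n (β ⟨w, h⟩) else Finset.univ

/-- The residue blocks partition the set of all embeddings. -/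
lemma sum_residueBlock {b : ℕ} (hb : 0 < b) (K₀ : Finset (Finset W)) (g : (W → Fin n) → ℝ) :
    ∑ β : {w // w ∈ cover K₀} → Fin b, ∑ φ ∈ blockMaps (residueBlock n K₀ β), g φ
      = ∑ φ ∈ blockMaps (fullBlock W n), g φ := by
  rw [← Finset.sum_fiberwise (blockMaps (fullBlock W n))
    (fun φ (w : {w // w ∈ cover K₀}) => (⟨(φ w : ℕ) % b, Nat.mod_lt _ hb⟩ : Fin b)) g]
  refine Finset.sum_congr rfl fun β _ => Finset.sum_congr ?_ fun _ _ => rfl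
  ext φ
  simp only [Finset.mem_filter, mem_blockMaps, Finset.mem_univ, implies_true, true_and]
  rw [and_comm]
  refine and_congr_right fun _ => ?_
  constructor
  · intro h
    ext w
    have := h w
    simpa [residueBlock, residueClass, w.2] using this
  · rintro rfl w
    by_cases h : w ∈ cover K₀ <;> simp [residueBlock, residueClass, h]

end Tails

/-! ### The lower bound by residue blocks -/

section ResidueBlocks

variable {W : Type*} [DecidableEq W] {k n : ℕ} {p : ℝ} {E K₀ : Finset (Finset W)}

section Residue

variable {b : ℕ} {β : {w // w ∈ cover K₀} → Fin b}

lemma residueBlock_of_mem {w : W} (h : w ∈ cover K₀) :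
    residueBlock n K₀ β w = residueClass n (β ⟨w, h⟩) := by simp [residueBlock, h]

lemma card_residueBlock_of_notMem {w : W} (h : w ∉ cover K₀) :
    (residueBlock n K₀ β w).card = n := by simp [residueBlock, h]

lemma blockMean_residueBlock_le (hp0 : 0 ≤ p) (hb : 0 < b) (hbn : b ≤ n) :
    blockMean p (residueBlock n K₀ β) K₀
      ≤ 2 ^ (cover K₀).card * (blockMean p (fullBlock W n) K₀ / (b : ℝ) ^ (cover K₀).card) := by
  have hb' : (0 : ℝ) < b := by exact_mod_cast hb
  rw [blockMean_fullBlock, blockMean]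
  calc _ ≤ (∏ w ∈ cover K₀, (2 * n / b : ℝ)) * p ^ K₀.card := by
        refine mul_le_mul_of_nonneg_right (Finset.prod_le_prod (fun _ _ => Nat.cast_nonneg _)
          fun w hw => ?_) (pow_nonneg hp0 _)
        rw [residueBlock_of_mem hw, le_div_iff₀ hb', mul_comm]
        exact_mod_cast card_residueClass_le _ hbn
    _ = _ := by
        rw [Finset.prod_const, div_pow, mul_pow]
        ring

lemma le_blockMean_residueBlock [Fintype W] (hp0 : 0 ≤ p) (hb : 0 < b) (hbn : b ≤ n) {Ψ : ℝ}
    (hΨ0 : 0 ≤ Ψ) {K : Finset (Finset W)} (hΨ : Ψ ≤ blockMean p (fullBlock W n) K) :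
    Ψ / (2 ^ (cover K₀).card * (b : ℝ) ^ (cover K₀).card)
      ≤ blockMean p (residueBlock n K₀ β) K := by
  have hb' : (1 : ℝ) ≤ b := by exact_mod_cast hb
  -- The fraction of all vertices of the random `k`-graph that `w` may be sent to is at least `g w`.
  set g : W → ℝ := fun w => if w ∈ cover K₀ then 1 / (2 * b : ℝ) else 1 with hg
  have hg0 : ∀ w, 0 ≤ g w := fun w => by simp only [hg]; split_ifs <;> positivity
  have hg1 : ∀ w, g w ≤ 1 := fun w => by
    simp only [hg]
    split_ifs
    · rw [div_le_one (by positivity)]; linarith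
    · exact le_rfl
  have hguniv : ∏ w, g w = 1 / (2 ^ (cover K₀).card * (b : ℝ) ^ (cover K₀).card) := by
    simp only [hg]
    rw [Finset.prod_ite_mem, Finset.univ_inter, Finset.prod_const, div_pow, one_pow, mul_pow]
  have hgK : ∏ w, g w ≤ ∏ w ∈ cover K, g w := by
    rw [← Finset.prod_mul_prod_compl (cover K)]
    exact mul_le_of_le_one_right (Finset.prod_nonneg fun w _ => hg0 w)
      (Finset.prod_le_one (fun w _ => hg0 w) fun w _ => hg1 w)
  have hcard : ∀ w, n * g w ≤ ((residueBlock n K₀ β w).card : ℝ) := by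
    intro w
    by_cases h : w ∈ cover K₀
    · simp only [hg, if_pos h]
      rw [residueBlock_of_mem h, mul_one_div, div_le_iff₀ (by positivity), mul_comm]
      exact_mod_cast le_card_residueClass _ hbn
    · simp only [hg, if_neg h]
      rw [card_residueBlock_of_notMem h, mul_one]
  calc _ = Ψ * ∏ w, g w := by rw [hguniv, mul_one_div]
    _ ≤ blockMean p (fullBlock W n) K * ∏ w ∈ cover K, g w := by
        refine mul_le_mul hΨ hgK (Finset.prod_nonneg fun w _ => hg0 w) (hΨ0.trans hΨ)
    _ = (∏ w ∈ cover K, n * g w) * p ^ K.card := by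
        rw [blockMean_fullBlock, Finset.prod_mul_distrib, Finset.prod_const]
        ring
    _ ≤ _ := by
        refine mul_le_mul_of_nonneg_right (Finset.prod_le_prod (fun w _ => ?_) fun w _ => hcard w)
          (pow_nonneg hp0 _)
        exact mul_nonneg (Nat.cast_nonneg _) (hg0 w)

end Residue

variable [Fintype W]

/-- The lower bound from splitting the embeddings into the residue blocks modulo `b`. If each block
falls short of its mean by the factor `1 - ε`, so does the total, and by Harris' inequality the
probability of the former is at least the product of the probabilities for the single blocks. -/
lemma pow_le_prob_embCount (hp0 : 0 < p) (hp1 : p < 1) (hE : ∀ e ∈ E, e.card = k)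
    (hK₀ : K₀ ⊆ E) (hne : K₀.Nonempty) {ε L G : ℝ} (hε : 0 ≤ ε)
    (hmin : ∀ K ⊆ E, K.Nonempty →
      blockMean p (fullBlock W n) K₀ ≤ blockMean p (fullBlock W n) K)
    {b : ℕ} (hb : 0 < b) (hbn : 4 * Fintype.card W ^ 2 * b ≤ n) (hW : 0 < Fintype.card W)
    (hG : G = 4 ^ Fintype.card W)
    (hL : L = 128 * (384 * overlapConst k E.card (Fintype.card W) ^ 3))
    (hΨ : 2 ^ (cover K₀).card * (b : ℝ) ^ (cover K₀).card ≤ blockMean p (fullBlock W n) K₀)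
    (hεb : L * G ^ 3 * ε ^ 2 * blockMean p (fullBlock W n) K₀
      ≤ (1 - p) ^ 3 * (b : ℝ) ^ (cover K₀).card) :
    ((1 - p) ^ 2 / (L * G ^ 2)) ^ (b ^ (cover K₀).card)
      ≤ prob p {S : Finset (KSubset k n) | embCount E S
        ≤ (1 - ε) * ((blockMaps (fullBlock W n)).card * p ^ E.card)} := by
  set Ψ := blockMean p (fullBlock W n) K₀ with hΨdef
  set u := (cover K₀).card with hu
  have huv : u ≤ Fintype.card W := Finset.card_le_univ _
  have hbr : (0 : ℝ) < b := by exact_mod_cast hb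
  have hΨ0 : 0 ≤ Ψ := le_trans (by positivity) hΨ
  have hv2 : 1 ≤ Fintype.card W ^ 2 := Nat.one_le_pow _ _ hW
  have hbn' : b ≤ n := le_trans (by nlinarith) hbn
  have hL0 : 0 < L := by
    have := overlapConst_pos k E.card (Fintype.card W)
    rw [hL]; positivity
  have hG0 : 0 < G := by rw [hG]; positivity
  have hq : 0 < 1 - p := by linarith
  set D : ({w // w ∈ cover K₀} → Fin b) → Set (Finset (KSubset k n)) := fun β =>
    {S | ∑ φ ∈ blockMaps (residueBlock n K₀ β), ind (edgeImage k E φ) S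
      ≤ (1 - ε) * ((blockMaps (residueBlock n K₀ β)).card * p ^ E.card)} with hD
  have hblock : ∀ β, (1 - p) ^ 2 / (L * G ^ 2) ≤ prob p (D β) := by
    intro β
    refine le_prob_block (Φ := Ψ / (2 ^ u * (b : ℝ) ^ u)) hp0 hp1 hE hK₀ hne ?_ ?_ hG0 hε hL
      ?_ ?_ ?_
    · intro w
      by_cases h : w ∈ cover K₀
      · rw [residueBlock_of_mem h]
        have := le_card_residueClass (β ⟨w, h⟩) hbn'
        refine Nat.le_of_mul_le_mul_left (?_ : 2 * b * _ ≤ 2 * b * _) (by positivity)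
        nlinarith
      · rw [card_residueBlock_of_notMem h]
        nlinarith
    · rwa [one_le_div (by positivity)]
    · exact fun K hK hK' => le_blockMean_residueBlock hp0.le hb hbn' hΨ0 (hmin K hK hK')
    · refine (blockMean_residueBlock_le hp0.le hb hbn').trans ?_
      have h4 : (4 : ℝ) ^ u ≤ G := by
        rw [hG]
        exact pow_le_pow_right₀ (by norm_num) huv
      have e : 2 ^ u * (Ψ / (b : ℝ) ^ u) = 4 ^ u * (Ψ / (2 ^ u * (b : ℝ) ^ u)) := by
        rw [show (4 : ℝ) = 2 * 2 by norm_num, mul_pow]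
        field_simp
      rw [← hΨdef, ← hu, e]
      gcongr
    · have h2 : (1 : ℝ) ≤ 2 ^ u := one_le_pow₀ (by norm_num)
      have h5 : Ψ / (2 ^ u * (b : ℝ) ^ u) ≤ Ψ / (b : ℝ) ^ u := by
        gcongr
        exact le_mul_of_one_le_left (by positivity) h2
      calc ε ^ 2 * (L * G ^ 3 * (Ψ / (2 ^ u * (b : ℝ) ^ u)))
          ≤ ε ^ 2 * (L * G ^ 3 * (Ψ / (b : ℝ) ^ u)) := by gcongr
        _ = L * G ^ 3 * ε ^ 2 * Ψ / (b : ℝ) ^ u := by ring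
        _ ≤ _ := by rwa [div_le_iff₀ (by positivity)]
  have hlow : ∀ β ∈ Finset.univ, IsLowerSet (D β) := fun β _ S S' h hS =>
    le_trans (Finset.sum_le_sum fun φ _ => monotone_ind _ h) hS
  have hcard : (Finset.univ : Finset ({w // w ∈ cover K₀} → Fin b)).card = b ^ u := by
    simp [hu]
  calc ((1 - p) ^ 2 / (L * G ^ 2)) ^ (b ^ u)
      = ∏ β : {w // w ∈ cover K₀} → Fin b, (1 - p) ^ 2 / (L * G ^ 2) := by
        rw [Finset.prod_const, hcard]
    _ ≤ ∏ β, prob p (D β) := Finset.prod_le_prod (fun _ _ => by positivity) fun β _ => hblock β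
    _ ≤ _ := prod_prob_le_prob_iInter hp0.le hp1.le _ D hlow
    _ ≤ _ := by
        refine prob_mono hp0.le hp1.le fun S hS => ?_
        have h1 : embCount E S = ∑ β : {w // w ∈ cover K₀} → Fin b,
            ∑ φ ∈ blockMaps (residueBlock n K₀ β), ind (edgeImage k E φ) S :=
          (sum_residueBlock hb K₀ _).symm
        have h2 : ((blockMaps (fullBlock W n)).card : ℝ) = ∑ β : {w // w ∈ cover K₀} → Fin b,
            ((blockMaps (residueBlock n K₀ β)).card : ℝ) := by
          have := sum_residueBlock (n := n) hb K₀ (fun _ => (1 : ℝ))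
          simpa using this.symm
        change embCount E S ≤ _
        rw [h1, h2, Finset.sum_mul, Finset.mul_sum]
        exact Finset.sum_le_sum fun β _ => hS β (Finset.mem_univ β)

/-- Up to the factor `2 ^ u`, every real number `t ≥ 1` is a `u`-th power of a positive integer. -/
lemma exists_pow_between {t : ℝ} (ht : 1 ≤ t) {u : ℕ} (hu : 0 < u) :
    ∃ b : ℕ, 0 < b ∧ t ≤ (b : ℝ) ^ u ∧ (b : ℝ) ^ u ≤ 2 ^ u * t := by
  have hex : ∃ b : ℕ, t ≤ (b : ℝ) ^ u := by
    obtain ⟨m, hm⟩ := exists_nat_ge t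
    have hm1 : (1 : ℝ) ≤ m := ht.trans hm
    exact ⟨m, hm.trans (le_self_pow₀ hm1 hu.ne')⟩
  classical
  have hspec := Nat.find_spec hex
  set b := Nat.find hex with hbdef
  have hb0 : 0 < b := by
    rcases Nat.eq_zero_or_pos b with h | h
    · rw [h, Nat.cast_zero, zero_pow hu.ne'] at hspec
      linarith
    · exact h
  refine ⟨b, hb0, hspec, ?_⟩
  rcases Nat.lt_or_ge 1 b with h | h
  · have h1 : ¬ t ≤ ((b - 1 : ℕ) : ℝ) ^ u := Nat.find_min hex (by omega)
    have h2 : (b : ℝ) ≤ 2 * ((b - 1 : ℕ) : ℝ) := by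
      have : b ≤ 2 * (b - 1) := by omega
      exact_mod_cast this
    calc (b : ℝ) ^ u ≤ (2 * ((b - 1 : ℕ) : ℝ)) ^ u := by gcongr
      _ = 2 ^ u * ((b - 1 : ℕ) : ℝ) ^ u := mul_pow _ _ _
      _ ≤ 2 ^ u * t := by
          have := (not_le.1 h1).le
          gcongr
  · have : b = 1 := by omega
    rw [this, Nat.cast_one, one_pow]
    have h2 : (1 : ℝ) ≤ 2 ^ u := one_le_pow₀ (by norm_num)
    nlinarith

/-- The lower bound on the lower tail of the number of embeddings. The constant `C` depends only on
the `k`-graph with edge set `E`, and `K₀` is a subgraph of least expected count. -/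
lemma lower_bound_embCount (hk : 0 < k) (hE : ∀ e ∈ E, e.card = k) (hEne : E.Nonempty) :
    ∃ C : ℝ, 0 < C ∧ ∀ (n : ℕ) (p ε : ℝ), 0 < p → p < 1 → 0 ≤ ε → ε ≤ 1 → ∀ K₀ ⊆ E, K₀.Nonempty →
      (∀ K ⊆ E, K.Nonempty →
        blockMean p (fullBlock W n) K₀ ≤ blockMean p (fullBlock W n) K) →
      1 ≤ ε ^ 2 * blockMean p (fullBlock W n) K₀ →
      Real.exp (-(C * ε ^ 2 * blockMean p (fullBlock W n) K₀ / (1 - p) ^ 5))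
        ≤ prob p {S : Finset (KSubset k n) | embCount E S
          ≤ (1 - ε) * ((blockMaps (fullBlock W n)).card * p ^ E.card)} := by
  set v := Fintype.card W with hv
  set G : ℝ := 4 ^ v with hG
  set L : ℝ := 128 * (384 * overlapConst k E.card v ^ 3) with hL
  set A : ℝ := (4 * (v : ℝ) ^ 2) ^ v with hA
  have hC1 : 1 ≤ overlapConst k E.card v := by
    refine one_le_mul_of_one_le_of_one_le (one_le_pow₀ (by norm_num)) (one_le_pow₀ ?_)
    exact Nat.one_le_cast.2 (Nat.le_add_left 1 _)
  have hG1 : 1 ≤ G := one_le_pow₀ (by norm_num)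
  have hL1 : 1 ≤ L := by
    have : 1 ≤ overlapConst k E.card v ^ 3 := one_le_pow₀ hC1
    rw [hL]; linarith
  have hLG : 1 ≤ L * G ^ 3 := one_le_mul_of_one_le_of_one_le hL1 (one_le_pow₀ hG1)
  have hv1 : 1 ≤ v := by
    obtain ⟨e, he⟩ := hEne
    have h1 : 0 < e.card := (hE e he).symm ▸ hk
    exact h1.trans_le (Finset.card_le_univ e)
  have hv1' : (1 : ℝ) ≤ v := by exact_mod_cast hv1
  have hbase : (2 : ℝ) ≤ 4 * (v : ℝ) ^ 2 := by nlinarith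
  have hA0 : 0 < A := by positivity
  refine ⟨2 ^ v * (L * G ^ 3) * (A + L * G ^ 2), by positivity, ?_⟩
  intro n p ε hp0 hp1 hε0 hε1 K₀ hK₀ hne hmin hD
  set Ψ := blockMean p (fullBlock W n) K₀ with hΨ
  set u := (cover K₀).card with hu
  have huv : u ≤ v := Finset.card_le_univ _
  have hu0 : 0 < u := by
    obtain ⟨e, he⟩ := hne
    have h1 : 0 < e.card := (hE e (hK₀ he)).symm ▸ hk
    exact h1.trans_le (Finset.card_le_card (Finset.subset_biUnion_of_mem id he))
  have hq : 0 < 1 - p := by linarith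
  have hq1 : 1 - p ≤ 1 := by linarith
  have hΨ0 : 0 < Ψ := by
    by_contra h
    have : ε ^ 2 * Ψ ≤ 0 := mul_nonpos_of_nonneg_of_nonpos (sq_nonneg _) (not_lt.1 h)
    linarith
  -- The number of blocks at which the standard deviation in a block is `ε` times the mean.
  set t : ℝ := L * G ^ 3 * (ε ^ 2 * Ψ) / (1 - p) ^ 3 with ht
  have ht1 : 1 ≤ t := by
    rw [ht, one_le_div (by positivity)]
    exact (pow_le_one₀ hq.le hq1).trans (one_le_mul_of_one_le_of_one_le hLG hD)
  obtain ⟨b, hb0, htb, hbt⟩ := exists_pow_between ht1 hu0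
  have hbr : (1 : ℝ) ≤ b := by exact_mod_cast hb0
  have hbt' : (b : ℝ) ^ u ≤ 2 ^ v * t := hbt.trans (by
    have : (2 : ℝ) ^ u ≤ 2 ^ v := pow_le_pow_right₀ (by norm_num) huv
    gcongr)
  by_cases hcase : A * (b : ℝ) ^ u ≤ Ψ
  · -- The residue classes are large enough for the blocks to have almost the expected size.
    have hbn : 4 * v ^ 2 * b ≤ n := by
      have h1 : (4 * (v : ℝ) ^ 2 * b) ^ u ≤ (n : ℝ) ^ u := by
        calc (4 * (v : ℝ) ^ 2 * b) ^ u = (4 * (v : ℝ) ^ 2) ^ u * (b : ℝ) ^ u := mul_pow _ _ _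
          _ ≤ A * (b : ℝ) ^ u := by
              have : (4 * (v : ℝ) ^ 2) ^ u ≤ A := pow_le_pow_right₀ (by linarith) huv
              gcongr
          _ ≤ Ψ := hcase
          _ = (n : ℝ) ^ u * p ^ K₀.card := blockMean_fullBlock K₀
          _ ≤ (n : ℝ) ^ u := mul_le_of_le_one_right (by positivity) (pow_le_one₀ hp0.le hp1.le)
      have h2 := le_of_pow_le_pow_left₀ hu0.ne' (Nat.cast_nonneg n) h1
      exact_mod_cast h2
    have h2A : 2 ^ u * (b : ℝ) ^ u ≤ Ψ := by
      refine le_trans ?_ hcase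
      have : (2 : ℝ) ^ u ≤ A := (pow_le_pow_right₀ (by norm_num) huv).trans
        (pow_le_pow_left₀ (by norm_num) hbase v)
      gcongr
    have hεb : L * G ^ 3 * ε ^ 2 * Ψ ≤ (1 - p) ^ 3 * (b : ℝ) ^ u := by
      rw [ht, div_le_iff₀ (by positivity)] at htb
      linarith
    refine le_trans ?_ (pow_le_prob_embCount hp0 hp1 hE hK₀ hne hε0 hmin hb0 hbn hv1 hG hL h2A hεb)
    set y := (1 - p) ^ 2 / (L * G ^ 2) with hy
    have hy0 : 0 < y := by positivity
    have hyexp : Real.exp (-(1 / y)) ≤ y := by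
      rw [Real.exp_neg, inv_le_comm₀ (Real.exp_pos _) hy0]
      have := Real.add_one_le_exp (1 / y)
      rw [← one_div]
      linarith
    refine le_trans ?_ (pow_le_pow_left₀ (Real.exp_pos _).le hyexp _)
    rw [← Real.exp_nat_mul]
    refine Real.exp_le_exp.2 ?_
    have h3 : ((b ^ u : ℕ) : ℝ) * (1 / y) ≤ 2 ^ v * (L * G ^ 3) * (A + L * G ^ 2) * ε ^ 2 * Ψ
        / (1 - p) ^ 5 := by
      push_cast
      calc (b : ℝ) ^ u * (1 / y) ≤ 2 ^ v * t * (1 / y) := by gcongr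
        _ = 2 ^ v * (L * G ^ 3) * (L * G ^ 2) * ε ^ 2 * Ψ / (1 - p) ^ 5 := by
            rw [ht, hy]; field_simp
        _ ≤ _ := by gcongr; linarith
    linarith
  · -- Otherwise `Ψ` is at most of the order of `t`, and the probability of having no embedding at
    -- all is large enough.
    refine le_trans ?_ ((exp_le_prob_embCount_eq_zero hp0.le hp1 hE hK₀ hne).trans
      (prob_mono hp0.le hp1.le fun S hS => ?_))
    · refine Real.exp_le_exp.2 (neg_le_neg ?_)
      calc Ψ / (1 - p) ≤ A * (2 ^ v * t) / (1 - p) := by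
            gcongr
            exact (not_le.1 hcase).le.trans (by gcongr)
        _ = 2 ^ v * (L * G ^ 3) * A * ε ^ 2 * Ψ / (1 - p) ^ 4 := by
            rw [ht]; field_simp
        _ ≤ 2 ^ v * (L * G ^ 3) * (A + L * G ^ 2) * ε ^ 2 * Ψ / (1 - p) ^ 5 := by
            have h5 : (1 - p) ^ 5 ≤ (1 - p) ^ 4 :=
              pow_le_pow_of_le_one hq.le hq1 (by norm_num)
            have h6 : 0 ≤ L * G ^ 2 := by positivity
            gcongr
            linarith
    · have h0 : embCount E S = 0 := hS
      change embCount E S ≤ _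
      rw [h0]
      exact mul_nonneg (by linarith) (by positivity)

end ResidueBlocks

/-! ### The law of the random `k`-graph -/

section Law

variable {k n : ℕ}

/-- A set of edges of the complete `k`-graph as a set of sets of vertices. -/
def toEdges (S : Finset (KSubset k n)) : Set (Set (Fin n)) := {e | ∃ f ∈ S, (f.1 : Set (Fin n)) = e}

lemma coe_KSubset_injective :
    Function.Injective (fun f : KSubset k n => (f.1 : Set (Fin n))) :=
  Finset.coe_injective.comp Subtype.val_injective

lemma toEdges_eq_image (S : Finset (KSubset k n)) :
    toEdges S = (fun f : KSubset k n => (f.1 : Set (Fin n))) '' S := rfl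

lemma toEdges_injective : Function.Injective (toEdges (k := k) (n := n)) := fun _ _ h =>
  Finset.coe_injective (coe_KSubset_injective.image_injective h)

lemma toEdges_univ : toEdges (Finset.univ : Finset (KSubset k n)) = {e | e.ncard = k} := by
  classical
  ext e
  simp only [toEdges, Finset.mem_univ, true_and, Set.mem_ofPred_eq]
  constructor
  · rintro ⟨f, rfl⟩
    rw [Set.ncard_coe_finset, f.2]
  · intro h
    refine ⟨⟨e.toFinite.toFinset, ?_⟩, by simp⟩
    rw [← Set.ncard_eq_toFinset_card _ e.toFinite, h]

lemma range_toEdges : Set.range (toEdges (k := k) (n := n)) = {s | s ⊆ {e | e.ncard = k}} := by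
  classical
  ext s
  simp only [Set.mem_range, Set.mem_ofPred_eq]
  rw [← toEdges_univ]
  constructor
  · rintro ⟨S, rfl⟩ e ⟨f, _, hf⟩
    exact ⟨f, Finset.mem_univ _, hf⟩
  · intro h
    refine ⟨Finset.univ.filter fun f => (f.1 : Set (Fin n)) ∈ s, ?_⟩
    ext e
    simp only [toEdges, Finset.mem_filter, Finset.mem_univ, true_and, Set.mem_ofPred_eq]
    constructor
    · rintro ⟨f, hf, rfl⟩
      exact hf
    · intro he
      obtain ⟨f, _, hf⟩ := h he
      exact ⟨f, hf ▸ he, hf⟩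

lemma randomEdges_real_singleton (p : unitInterval) (S : Finset (KSubset k n)) :
    (randomEdges k n p).real {toEdges S} = weight (p : ℝ) S := by
  have hsub : toEdges S ⊆ {e | e.ncard = k} := by
    have : toEdges S ∈ Set.range (toEdges (k := k) (n := n)) := ⟨S, rfl⟩
    rwa [range_toEdges] at this
  have h1 : (toEdges S).ncard = S.card := by
    rw [toEdges_eq_image, Set.ncard_image_of_injective _ coe_KSubset_injective,
      Set.ncard_coe_finset]
  have h2 : ({e : Set (Fin n) | e.ncard = k} \ toEdges S).ncard = Sᶜ.card := by
    rw [← toEdges_univ, toEdges_eq_image, toEdges_eq_image,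
      ← Set.image_sdiff coe_KSubset_injective,
      Set.ncard_image_of_injective _ coe_KSubset_injective, ← Finset.coe_sdiff,
      Set.ncard_coe_finset, Finset.compl_eq_univ_sdiff]
  rw [randomEdges, setBernoulli_real_singleton p hsub (Set.toFinite _), h1, h2, weight]

lemma integral_randomEdges (p : unitInterval) (g : Set (Set (Fin n)) → ℝ) :
    ∫ S, g S ∂(randomEdges k n p)
      = expect (p : ℝ) fun S : Finset (KSubset k n) => g (toEdges S) := by
  classical
  have : IsProbabilityMeasure (randomEdges k n p) := by unfold randomEdges; infer_instance
  rw [integral_fintype .of_finite, expect]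
  refine (Fintype.sum_of_injective toEdges toEdges_injective _ _ ?_ ?_).symm
  · intro s hs
    rw [range_toEdges] at hs
    rw [randomEdges, measureReal_def, setBernoulli_singleton_of_not_subset p hs]
    simp
  · intro S
    rw [randomEdges_real_singleton, smul_eq_mul]

lemma randomEdges_real (p : unitInterval) (D : Set (Set (Set (Fin n)))) :
    (randomEdges k n p).real D = prob (p : ℝ) {S : Finset (KSubset k n) | toEdges S ∈ D} := by
  rw [← integral_indicator_one .of_discrete, integral_randomEdges]
  rfl

end Law

/-! ### Copies and embeddings -/

section Copies

variable {α : Type*} {k n : ℕ} (J : Hypergraph α)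

/-- The edges of a hypergraph as finite sets of its vertices. -/
noncomputable def edgeFinset [Fintype J.vertexSet] : Finset (Finset J.vertexSet) := by
  classical
  exact Finset.univ.filter fun e => Subtype.val '' (e : Set J.vertexSet) ∈ J.edgeSet

variable {J}

lemma mem_edgeFinset [Fintype J.vertexSet] {e : Finset J.vertexSet} :
    e ∈ edgeFinset J ↔ Subtype.val '' (e : Set J.vertexSet) ∈ J.edgeSet := by
  simp [edgeFinset]

lemma image_edgeFinset [Fintype J.vertexSet] :
    (fun e : Finset J.vertexSet => Subtype.val '' (e : Set J.vertexSet)) '' (edgeFinset J)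
      = J.edgeSet := by
  classical
  ext e
  constructor
  · rintro ⟨e, he, rfl⟩
    exact mem_edgeFinset.1 he
  · intro he
    have hsub := J.subset_vertexSet_of_mem_edgeSet' he
    have h : Subtype.val '' (((Subtype.val ⁻¹' e : Set J.vertexSet).toFinset : Finset _) :
        Set J.vertexSet) = e := by
      rw [Set.coe_toFinset, Subtype.image_preimage_coe, Set.inter_eq_right]
      exact hsub
    exact ⟨_, mem_edgeFinset.2 (h.symm ▸ he), h⟩

lemma card_edgeFinset [Fintype J.vertexSet] : (edgeFinset J).card = J.edgeSet.ncard := by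
  have hinj : Function.Injective
      (fun e : Finset J.vertexSet => Subtype.val '' (e : Set J.vertexSet)) :=
    Subtype.val_injective.image_injective.comp Finset.coe_injective
  rw [← image_edgeFinset, Set.ncard_image_of_injective _ hinj, Set.ncard_coe_finset]

lemma card_of_mem_edgeFinset [Fintype J.vertexSet] (hJ : IsKGraph k J) {e : Finset J.vertexSet}
    (he : e ∈ edgeFinset J) : e.card = k := by
  rw [← hJ.2 _ (mem_edgeFinset.1 he), Set.ncard_image_of_injective _ Subtype.val_injective,
    Set.ncard_coe_finset]

/-- The image of `J` under a vertex map, as a hypergraph. -/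
def mapHypergraph (J : Hypergraph α) (φ : J.vertexSet → Fin n) : Hypergraph (Fin n) where
  vertexSet := Set.range φ
  edgeSet := {f | ∃ e : Set J.vertexSet, Subtype.val '' e ∈ J.edgeSet ∧ φ '' e = f}
  subset_vertexSet_of_mem_edgeSet' := by
    rintro f ⟨e, _, rfl⟩
    exact Set.image_subset_range _ _

lemma image_mem_edgeSet_mapHypergraph {φ : J.vertexSet → Fin n} (hφ : Function.Injective φ)
    {e : Set J.vertexSet} :
    φ '' e ∈ (mapHypergraph J φ).edgeSet ↔ Subtype.val '' e ∈ J.edgeSet := by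
  constructor
  · rintro ⟨e', he', h⟩
    rwa [← hφ.image_injective h]
  · exact fun h => ⟨e, h, rfl⟩

lemma edgeImage_subset_iff [Fintype J.vertexSet] (hJ : IsKGraph k J) {φ : J.vertexSet → Fin n}
    (hφ : Function.Injective φ) {S : Finset (KSubset k n)} :
    edgeImage k (edgeFinset J) φ ⊆ S ↔ (mapHypergraph J φ).edgeSet ⊆ toEdges S := by
  classical
  constructor
  · rintro h f ⟨e, he, rfl⟩
    have he' : e.toFinset ∈ edgeFinset J := mem_edgeFinset.2 (by rwa [Set.coe_toFinset])
    have hcard : (e.toFinset.image φ).card = k :=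
      (Finset.card_image_of_injective _ hφ).trans (card_of_mem_edgeFinset hJ he')
    refine ⟨⟨e.toFinset.image φ, hcard⟩, h (mem_edgeImage.2 ⟨_, he', rfl⟩), ?_⟩
    simp
  · intro h f hf
    obtain ⟨e, he, hef⟩ := mem_edgeImage.1 hf
    obtain ⟨g, hg, hgf⟩ := h ((image_mem_edgeSet_mapHypergraph hφ).2 (mem_edgeFinset.1 he))
    rw [← Finset.coe_image, Finset.coe_inj, hef] at hgf
    rwa [← Subtype.ext hgf]

lemma isIsomorphic_mapHypergraph {φ : J.vertexSet → Fin n} (hφ : Function.Injective φ) :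
    IsIsomorphic J (mapHypergraph J φ) := by
  refine ⟨Equiv.ofInjective φ hφ, fun e => ?_⟩
  have h : Subtype.val '' (Equiv.ofInjective φ hφ '' e) = φ '' e := by
    rw [← Set.image_comp]; rfl
  change _ ↔ Subtype.val '' (Equiv.ofInjective φ hφ '' e) ∈ _
  rw [h, image_mem_edgeSet_mapHypergraph hφ]

lemma exists_eq_mapHypergraph {J' : Hypergraph (Fin n)} (h : IsIsomorphic J J') :
    ∃ φ : J.vertexSet → Fin n, Function.Injective φ ∧ mapHypergraph J φ = J' := by
  obtain ⟨ψ, hψ⟩ := h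
  refine ⟨fun w => (ψ w : Fin n), Subtype.val_injective.comp ψ.injective, ?_⟩
  have him : ∀ e : Set J.vertexSet, (fun w => (ψ w : Fin n)) '' e = Subtype.val '' (ψ '' e) :=
    fun e => by rw [← Set.image_comp]; rfl
  refine Hypergraph.ext ?_ ?_
  · change Set.range (Subtype.val ∘ ψ) = _
    rw [Set.range_comp, ψ.surjective.range_eq, Set.image_univ, Subtype.range_coe]
  · ext f
    constructor
    · rintro ⟨e, he, rfl⟩
      rw [him]
      exact (hψ e).1 he
    · intro hf
      have hsub := J'.subset_vertexSet_of_mem_edgeSet' hf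
      have h1 : Subtype.val '' (ψ '' (ψ ⁻¹' (Subtype.val ⁻¹' f))) = f := by
        rw [Set.image_preimage_eq _ ψ.surjective, Subtype.image_preimage_coe,
          Set.inter_eq_right]
        exact hsub
      exact ⟨ψ ⁻¹' (Subtype.val ⁻¹' f), (hψ _).2 (h1.symm ▸ hf), (him _).trans h1⟩

/-- The automorphisms of a hypergraph. -/
noncomputable def automorphisms (J : Hypergraph α) [Fintype J.vertexSet] :
    Finset (Equiv.Perm J.vertexSet) := by
  classical
  exact Finset.univ.filter fun σ => ∀ e : Set J.vertexSet,
    Subtype.val '' (σ '' e) ∈ J.edgeSet ↔ Subtype.val '' e ∈ J.edgeSet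

lemma mem_automorphisms [Fintype J.vertexSet] {σ : Equiv.Perm J.vertexSet} :
    σ ∈ automorphisms J ↔ ∀ e : Set J.vertexSet,
      Subtype.val '' (σ '' e) ∈ J.edgeSet ↔ Subtype.val '' e ∈ J.edgeSet := by
  simp [automorphisms]

lemma card_automorphisms_pos [Fintype J.vertexSet] : 0 < (automorphisms J).card :=
  Finset.card_pos.2 ⟨1, mem_automorphisms.2 fun e => by simp⟩

lemma card_automorphisms_le [Fintype J.vertexSet] :
    (automorphisms J).card ≤ (Fintype.card J.vertexSet).factorial := by
  classical
  rw [← Fintype.card_perm]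
  exact Finset.card_le_univ _

/-- The embeddings with the same image as `φ₀` differ from `φ₀` by an automorphism. -/
lemma card_filter_mapHypergraph_eq [Fintype J.vertexSet] {φ₀ : J.vertexSet → Fin n}
    (hφ₀ : Function.Injective φ₀) (T : Finset (J.vertexSet → Fin n))
    [DecidablePred fun φ : J.vertexSet → Fin n => mapHypergraph J φ = mapHypergraph J φ₀]
    (hT : ∀ φ : J.vertexSet → Fin n, mapHypergraph J φ = mapHypergraph J φ₀ →
      (φ ∈ T ↔ Function.Injective φ)) :
    (T.filter fun φ => mapHypergraph J φ = mapHypergraph J φ₀).card = (automorphisms J).card := by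
  symm
  refine Finset.card_bij (fun σ _ => φ₀ ∘ σ) ?_ ?_ ?_
  · intro σ hσ
    rw [mem_automorphisms] at hσ
    have heq : mapHypergraph J (φ₀ ∘ σ) = mapHypergraph J φ₀ := by
      refine Hypergraph.ext (σ.surjective.range_comp φ₀) ?_
      ext f
      constructor
      · rintro ⟨e, he, rfl⟩
        exact ⟨σ '' e, (hσ e).2 he, by rw [← Set.image_comp]⟩
      · rintro ⟨e, he, rfl⟩
        refine ⟨σ ⁻¹' e, (hσ _).1 ?_, ?_⟩
        · rwa [Set.image_preimage_eq _ σ.surjective]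
        · rw [Set.image_comp, Set.image_preimage_eq _ σ.surjective]
    exact Finset.mem_filter.2 ⟨(hT _ heq).2 (hφ₀.comp σ.injective), heq⟩
  · intro σ _ τ _ h
    exact Equiv.ext fun w => hφ₀ (congrFun h w)
  · intro φ hφ
    obtain ⟨hφT, heq⟩ := Finset.mem_filter.1 hφ
    have hinj := (hT φ heq).1 hφT
    have hrange : Set.range φ = Set.range φ₀ := congrArg Hypergraph.vertexSet heq
    set σ : Equiv.Perm J.vertexSet := (Equiv.ofInjective φ hinj).trans
      ((Equiv.setCongr hrange).trans (Equiv.ofInjective φ₀ hφ₀).symm) with hσ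
    have hcomp : φ₀ ∘ σ = φ := by
      ext w
      have : (Equiv.ofInjective φ₀ hφ₀ (σ w) : Fin n) = φ w := by simp [hσ]
      simpa using congrArg Fin.val this
    refine ⟨σ, mem_automorphisms.2 fun e => ?_, hcomp⟩
    rw [← image_mem_edgeSet_mapHypergraph hφ₀, ← Set.image_comp, hcomp, ← heq,
      image_mem_edgeSet_mapHypergraph hinj]

/-- Each copy of `J` is the image of exactly `|Aut J|` embeddings. -/
lemma embCount_eq [Fintype J.vertexSet] [DecidableEq J.vertexSet] (hJ : IsKGraph k J)
    (S : Finset (KSubset k n)) :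
    embCount (edgeFinset J) S = (automorphisms J).card * X J n (toEdges S) := by
  classical
  set T := (blockMaps (fullBlock J.vertexSet n)).filter
    fun φ => edgeImage k (edgeFinset J) φ ⊆ S with hT
  have hmemT : ∀ φ, φ ∈ T ↔ Function.Injective φ ∧ (mapHypergraph J φ).edgeSet ⊆ toEdges S := by
    intro φ
    rw [hT, Finset.mem_filter, mem_blockMaps]
    simp only [Finset.mem_univ, implies_true, true_and]
    exact and_congr_right fun hφ => edgeImage_subset_iff hJ hφ
  have h1 : embCount (edgeFinset J) S = T.card := by
    simp [embCount, ind, hT]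
  have hcopies : {J' : Hypergraph (Fin n) | IsSubgraph J' (ofEdgeSet n (toEdges S)) ∧
      IsIsomorphic J J'} = ((T.image (mapHypergraph J) : Finset _) : Set (Hypergraph (Fin n))) := by
    ext J'
    rw [Finset.coe_image]
    constructor
    · rintro ⟨hsub, hiso⟩
      obtain ⟨φ, hφ, rfl⟩ := exists_eq_mapHypergraph hiso
      exact ⟨φ, (hmemT φ).2 ⟨hφ, hsub.2⟩, rfl⟩
    · rintro ⟨φ, hφ, rfl⟩
      have := (hmemT φ).1 hφ
      exact ⟨⟨Set.subset_univ _, this.2⟩, isIsomorphic_mapHypergraph this.1⟩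
  have h2 : X J n (toEdges S) = (T.image (mapHypergraph J)).card := by
    rw [X, copyCount, hcopies, Set.ncard_coe_finset]
  rw [h1, h2, Finset.card_eq_sum_card_image (mapHypergraph J) T]
  rw [Finset.sum_congr rfl (g := fun _ => (automorphisms J).card), Finset.sum_const, smul_eq_mul]
  · push_cast; ring
  · intro J' hJ'
    obtain ⟨φ₀, hφ₀, rfl⟩ := Finset.mem_image.1 hJ'
    have h0 := (hmemT φ₀).1 hφ₀
    refine card_filter_mapHypergraph_eq h0.1 T fun φ hφ => ?_
    rw [hmemT, hφ]
    exact and_iff_left h0.2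

end Copies

/-! ### Expected subgraph counts -/

section Expectation

variable {α : Type*} {k n : ℕ} {J H : Hypergraph α}

lemma expect_embCount {W : Type*} [DecidableEq W] [Fintype W] {E : Finset (Finset W)}
    (hE : ∀ e ∈ E, e.card = k) (p : ℝ) :
    expect p (fun S : Finset (KSubset k n) => embCount E S)
      = (blockMaps (fullBlock W n)).card * p ^ E.card := by
  simp only [embCount]
  rw [expect_sum, Finset.sum_congr rfl fun φ hφ => by
    rw [expect_ind, card_edgeImage hE (mem_blockMaps.1 hφ).2], Finset.sum_const, nsmul_eq_mul]

lemma automorphisms_mul_EX [Fintype J.vertexSet] [DecidableEq J.vertexSet] (hJ : IsKGraph k J)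
    (p : unitInterval) :
    (automorphisms J).card * EX k J n p
      = (blockMaps (fullBlock J.vertexSet n)).card * (p : ℝ) ^ (edgeFinset J).card := by
  rw [EX, integral_randomEdges, ← expect_const_mul,
    ← expect_embCount fun e he => card_of_mem_edgeFinset hJ he]
  simp_rw [embCount_eq hJ]

lemma lowerTail_eq [Fintype H.vertexSet] [DecidableEq H.vertexSet] (hH : IsKGraph k H)
    (p : unitInterval) (ε : ℝ) :
    lowerTail k H n p ε = prob (p : ℝ) {S : Finset (KSubset k n) | embCount (edgeFinset H) S
      ≤ (1 - ε)
        * ((blockMaps (fullBlock H.vertexSet n)).card * (p : ℝ) ^ (edgeFinset H).card)} := by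
  rw [lowerTail, randomEdges_real, ← automorphisms_mul_EX hH]
  congr 1
  ext S
  have ha : (0 : ℝ) < (automorphisms H).card := by exact_mod_cast card_automorphisms_pos
  simp only [Set.mem_ofPred_eq]
  rw [embCount_eq hH, mul_left_comm, mul_le_mul_iff_right₀ ha]

lemma EX_nonneg (p : unitInterval) : 0 ≤ EX k J n p :=
  integral_nonneg fun _ => Nat.cast_nonneg _

lemma EX_le (hJ : IsKGraph k J) (p : unitInterval) :
    EX k J n p ≤ (n : ℝ) ^ J.vertexSet.ncard * (p : ℝ) ^ J.edgeSet.ncard := by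
  classical
  have := hJ.1.fintype
  have h1 := automorphisms_mul_EX (n := n) hJ p
  have h2 : (1 : ℝ) ≤ (automorphisms J).card := by exact_mod_cast card_automorphisms_pos
  have h3 := card_blockMaps_le (fullBlock J.vertexSet n)
  have h4 := EX_nonneg (k := k) (J := J) (n := n) p
  simp only [Finset.card_univ, Fintype.card_fin, Finset.prod_const] at h3
  rw [card_edgeFinset] at h1
  rw [← Nat.card_coe_set_eq J.vertexSet, Nat.card_eq_fintype_card]
  calc EX k J n p ≤ (automorphisms J).card * EX k J n p := le_mul_of_one_le_left h4 h2
    _ = _ := h1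
    _ ≤ _ := mul_le_mul_of_nonneg_right h3 (pow_nonneg p.2.1 _)

lemma le_EX (hJ : IsKGraph k J) (p : unitInterval) (hn : 2 * J.vertexSet.ncard ^ 2 ≤ n) :
    (n : ℝ) ^ J.vertexSet.ncard * (p : ℝ) ^ J.edgeSet.ncard
      ≤ 2 * J.vertexSet.ncard.factorial * EX k J n p := by
  classical
  have := hJ.1.fintype
  have h1 := automorphisms_mul_EX (n := n) hJ p
  have h2 : ((automorphisms J).card : ℝ) ≤ (Fintype.card J.vertexSet).factorial := by
    exact_mod_cast card_automorphisms_le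
  rw [← Nat.card_coe_set_eq J.vertexSet, Nat.card_eq_fintype_card] at hn ⊢
  have h3 := prod_card_le_two_mul_card_blockMaps (fullBlock J.vertexSet n)
    fun w => by simpa using hn
  have h4 := EX_nonneg (k := k) (J := J) (n := n) p
  simp only [Finset.card_univ, Fintype.card_fin, Finset.prod_const] at h3
  rw [card_edgeFinset] at h1
  calc _ ≤ 2 * ((blockMaps (fullBlock J.vertexSet n)).card : ℝ) * (p : ℝ) ^ J.edgeSet.ncard :=
        mul_le_mul_of_nonneg_right h3 (pow_nonneg p.2.1 _)
    _ = 2 * (automorphisms J).card * EX k J n p := by rw [mul_assoc, ← h1, mul_assoc]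
    _ ≤ _ := by gcongr

lemma IsSubgraph.isKGraph (hH : IsKGraph k H) (h : IsSubgraph J H) : IsKGraph k J :=
  ⟨hH.1.subset h.1, fun e he => hH.2 e (h.2 he)⟩

/-- `Φ_H` is at most the expected number of copies of the subgraph with edge set `K`. -/
lemma Phi_le_blockMean [Fintype H.vertexSet] [DecidableEq H.vertexSet] (hH : IsKGraph k H)
    (p : unitInterval) {K : Finset (Finset H.vertexSet)} (hK : K ⊆ edgeFinset H)
    (hne : K.Nonempty) :
    Phi k H n p ≤ blockMean (p : ℝ) (fullBlock H.vertexSet n) K := by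
  set f : Finset H.vertexSet → Set α := fun e => Subtype.val '' (e : Set H.vertexSet) with hf
  have hinj : Function.Injective f :=
    Subtype.val_injective.image_injective.comp Finset.coe_injective
  let J : Hypergraph α :=
    { vertexSet := f (cover K)
      edgeSet := f '' K
      subset_vertexSet_of_mem_edgeSet' := by
        rintro _ ⟨e, he, rfl⟩
        exact Set.image_mono (Finset.coe_subset.2 (Finset.subset_biUnion_of_mem id he)) }
  have hsub : IsSubgraph J H := by
    refine ⟨?_, ?_⟩
    · rintro _ ⟨w, _, rfl⟩
      exact w.2
    · rintro _ ⟨e, he, rfl⟩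
      exact mem_edgeFinset.1 (hK he)
  have hle : Phi k H n p ≤ EX k J n p := by
    refine csInf_le ⟨0, ?_⟩ ⟨J, hsub, ?_, rfl⟩
    · rintro _ ⟨J', _, _, rfl⟩
      exact EX_nonneg p
    · exact (Finset.coe_nonempty.2 hne).image f
  refine hle.trans ((EX_le (hsub.isKGraph hH) p).trans (le_of_eq ?_))
  have hv : J.vertexSet.ncard = (cover K).card := by
    exact (Set.ncard_image_of_injective _ Subtype.val_injective).trans (Set.ncard_coe_finset _)
  have he : J.edgeSet.ncard = K.card := by
    exact (Set.ncard_image_of_injective _ hinj).trans (Set.ncard_coe_finset _)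
  rw [blockMean_fullBlock, hv, he]

/-- Isolated vertices only increase the expected number of copies, so that up to a constant factor
`Φ_H` is attained by a subgraph without isolated vertices. -/
lemma le_Phi [Fintype H.vertexSet] [DecidableEq H.vertexSet] (hH : IsKGraph k H)
    (he : H.edgeSet.Nonempty) (p : unitInterval) (hn : 2 * Fintype.card H.vertexSet ^ 2 ≤ n)
    (hn0 : 0 < n) {Ψ : ℝ}
    (hmin : ∀ K ⊆ edgeFinset H, K.Nonempty →
      Ψ ≤ blockMean (p : ℝ) (fullBlock H.vertexSet n) K) :
    Ψ ≤ 2 * (Fintype.card H.vertexSet).factorial * Phi k H n p := by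
  classical
  have hc0 : (0 : ℝ) < 2 * (Fintype.card H.vertexSet).factorial := by
    have := Nat.factorial_pos (Fintype.card H.vertexSet)
    positivity
  rw [← div_le_iff₀' hc0]
  refine le_csInf ⟨_, H, ⟨subset_rfl, subset_rfl⟩, he, rfl⟩ ?_
  rintro _ ⟨J, hsub, hJe, rfl⟩
  rw [div_le_iff₀' hc0]
  set f : Finset H.vertexSet → Set α := fun e => Subtype.val '' (e : Set H.vertexSet) with hf
  have hinj : Function.Injective f :=
    Subtype.val_injective.image_injective.comp Finset.coe_injective
  set K := (edgeFinset H).filter fun e => f e ∈ J.edgeSet with hK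
  have hfK : f '' K = J.edgeSet := by
    ext e
    constructor
    · rintro ⟨e, he, rfl⟩
      exact (Finset.mem_filter.1 he).2
    · intro he
      have h1 : e ∈ f '' (edgeFinset H) := by
        rw [hf, image_edgeFinset]
        exact hsub.2 he
      obtain ⟨e, heH, rfl⟩ := h1
      exact ⟨e, Finset.mem_coe.2 (Finset.mem_filter.2 ⟨heH, he⟩), rfl⟩
  have hKne : K.Nonempty := by
    rw [← Finset.coe_nonempty, ← Set.image_nonempty (f := f), hfK]
    exact hJe
  have hKcard : K.card = J.edgeSet.ncard := by
    rw [← hfK, Set.ncard_image_of_injective _ hinj, Set.ncard_coe_finset]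
  have hJfin := hH.1.subset hsub.1
  have hcover : (cover K).card ≤ J.vertexSet.ncard := by
    rw [← Set.ncard_coe_finset, ← Set.ncard_image_of_injective _ Subtype.val_injective]
    refine Set.ncard_le_ncard ?_ hJfin
    rintro _ ⟨w, hw, rfl⟩
    obtain ⟨e, heK, hwe⟩ := Finset.mem_biUnion.1 hw
    exact J.subset_vertexSet_of_mem_edgeSet' (Finset.mem_filter.1 heK).2 ⟨w, hwe, rfl⟩
  have hvJ : J.vertexSet.ncard ≤ Fintype.card H.vertexSet := by
    rw [← Nat.card_eq_fintype_card, Nat.card_coe_set_eq]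
    exact Set.ncard_le_ncard hsub.1 hH.1
  have hn1 : (1 : ℝ) ≤ n := by exact_mod_cast hn0
  calc Ψ ≤ blockMean (p : ℝ) (fullBlock H.vertexSet n) K := hmin K (Finset.filter_subset _ _) hKne
    _ = (n : ℝ) ^ (cover K).card * (p : ℝ) ^ K.card := blockMean_fullBlock K
    _ ≤ (n : ℝ) ^ J.vertexSet.ncard * (p : ℝ) ^ J.edgeSet.ncard := by
        rw [hKcard]
        exact mul_le_mul_of_nonneg_right (pow_le_pow_right₀ hn1 hcover) (pow_nonneg p.2.1 _)
    _ ≤ 2 * J.vertexSet.ncard.factorial * EX k J n p :=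
        le_EX (hsub.isKGraph hH) p (le_trans (by gcongr) hn)
    _ ≤ _ := by
        have h1 : (J.vertexSet.ncard.factorial : ℝ) ≤ (Fintype.card H.vertexSet).factorial := by
          exact_mod_cast Nat.factorial_le hvJ
        exact mul_le_mul_of_nonneg_right (by linarith) (EX_nonneg p)

end Expectation

end LowerTail

theorem mainTheorem3 {α : Type*} (k : ℕ) (hk : 2 ≤ k) (H : Hypergraph α)
    (hH : LowerTail.IsKGraph k H) (he : H.edgeSet.Nonempty) :
    ∃ (c C D : ℝ) (n₀ : ℕ), 0 < c ∧ 0 < C ∧ 0 < D ∧ 0 < n₀ ∧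
      ∀ n : ℕ, n₀ ≤ n → ∀ p : unitInterval, (p : ℝ) < 1 →
        ∀ ε : ℝ, 0 ≤ ε → ε ≤ 1 →
          (if ε < 1 then D else 0) ≤ ε ^ 2 * LowerTail.Phi k H n p →
          Real.exp (-((1 - (p : ℝ)) ^ (-5 : ℤ) * C * ε ^ 2 * LowerTail.Phi k H n p)) ≤
              LowerTail.lowerTail k H n p ε ∧
            LowerTail.lowerTail k H n p ε ≤
              Real.exp (-(c * ε ^ 2 * LowerTail.Phi k H n p)) := by
  classical
  have := hH.1.fintype
  set E := LowerTail.edgeFinset H with hEdef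
  have hE : ∀ e ∈ E, e.card = k := fun e he => LowerTail.card_of_mem_edgeFinset hH he
  have hEne : E.Nonempty := by
    rw [← Finset.coe_nonempty,
      ← Set.image_nonempty
        (f := fun e : Finset H.vertexSet => Subtype.val '' (e : Set H.vertexSet)),
      hEdef, LowerTail.image_edgeFinset]
    exact he
  set C₁ := LowerTail.overlapConst k E.card (Fintype.card H.vertexSet) with hC₁
  have hC₁0 : 0 < C₁ := LowerTail.overlapConst_pos _ _ _
  set F : ℝ := 2 * (Fintype.card H.vertexSet).factorial with hF
  have hF0 : 0 < F := by
    have := Nat.factorial_pos (Fintype.card H.vertexSet)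
    positivity
  obtain ⟨C₂, hC₂, hlower⟩ := LowerTail.lower_bound_embCount (by omega) hE hEne
  refine ⟨(4 * C₁)⁻¹, (C₂ + 1) * F, 1, 2 * Fintype.card H.vertexSet ^ 2 + 1,
    by positivity, by positivity, one_pos, by positivity, fun n hn p hp1 ε hε0 hε1 hD => ?_⟩
  set Φ := LowerTail.Phi k H n p with hΦ
  obtain ⟨K₀, hK₀mem, hK₀min⟩ := Finset.exists_min_image (E.powerset.filter Finset.Nonempty)
    (LowerTail.blockMean (p : ℝ) (LowerTail.fullBlock H.vertexSet n))
    ⟨E, Finset.mem_filter.2 ⟨Finset.mem_powerset_self E, hEne⟩⟩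
  obtain ⟨hK₀, hne⟩ := Finset.mem_filter.1 hK₀mem
  rw [Finset.mem_powerset] at hK₀
  have hmin : ∀ K ⊆ E, K.Nonempty →
      LowerTail.blockMean (p : ℝ) (LowerTail.fullBlock H.vertexSet n) K₀
      ≤ LowerTail.blockMean (p : ℝ) (LowerTail.fullBlock H.vertexSet n) K := fun K hK hK' =>
    hK₀min K (Finset.mem_filter.2 ⟨Finset.mem_powerset.2 hK, hK'⟩)
  have hΦΨ := LowerTail.Phi_le_blockMean (n := n) hH p hK₀ hne
  have hΨΦ := LowerTail.le_Phi hH he p (by omega) (by omega) hmin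
  have hp0 : 0 ≤ (p : ℝ) := p.2.1
  have hq : 0 < 1 - (p : ℝ) := by linarith
  have hq1 : 1 - (p : ℝ) ≤ 1 := by linarith
  rw [← hΦ] at hΦΨ hΨΦ
  set Ψ := LowerTail.blockMean (p : ℝ) (LowerTail.fullBlock H.vertexSet n) K₀ with hΨ
  have hΨ0 : 0 ≤ Ψ := by
    rw [hΨ, LowerTail.blockMean_fullBlock]
    positivity
  have hΦ0 : 0 ≤ Φ := by
    by_contra h
    have := mul_neg_of_pos_of_neg hF0 (not_le.1 h)
    linarith
  have hCexp : ∀ a : ℝ, a ≤ (C₂ + 1) * ε ^ 2 * Ψ / (1 - (p : ℝ)) ^ 5 →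
      Real.exp (-((1 - (p : ℝ)) ^ (-5 : ℤ) * ((C₂ + 1) * F) * ε ^ 2 * Φ)) ≤ Real.exp (-a) := by
    intro a ha
    refine Real.exp_le_exp.2 (neg_le_neg (ha.trans ?_))
    have hz : (1 - (p : ℝ)) ^ (-5 : ℤ) = ((1 - (p : ℝ)) ^ 5)⁻¹ := by
      rw [zpow_neg]; norm_cast
    rw [hz]
    calc _ ≤ (C₂ + 1) * ε ^ 2 * (F * Φ) / (1 - (p : ℝ)) ^ 5 := by gcongr
      _ = _ := by ring
  rw [LowerTail.lowerTail_eq hH]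
  constructor
  · rcases lt_or_eq_of_le hε1 with hlt | rfl
    · rw [if_pos hlt] at hD
      have hD' : 1 ≤ ε ^ 2 * Ψ := hD.trans (by gcongr)
      -- For `p = 0` the condition on `ε ^ 2 * Φ` fails.
      have hp0' : 0 < (p : ℝ) := by
        rcases lt_or_eq_of_le hp0 with h | h
        · exact h
        · have : Ψ = 0 := by
            rw [hΨ, LowerTail.blockMean_fullBlock, ← h, zero_pow hne.card_pos.ne', mul_zero]
          rw [this] at hD'
          linarith
      refine (hCexp _ ?_).trans (hlower n p ε hp0' hp1 hε0 hε1 K₀ hK₀ hne hmin hD')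
      gcongr
      linarith
    · have h0 := LowerTail.exp_le_prob_embCount_eq_zero (n := n) hp0 hp1 hE hK₀ hne
      refine (hCexp _ ?_).trans (h0.trans (LowerTail.prob_mono hp0 hp1.le fun S hS => ?_))
      · rw [← hΨ]
        have h5 : (1 - (p : ℝ)) ^ 5 ≤ 1 - p := pow_le_of_le_one hq.le hq1 (by norm_num)
        calc Ψ / (1 - p) ≤ Ψ / (1 - (p : ℝ)) ^ 5 := by gcongr
          _ ≤ _ := by
              gcongr
              nlinarith
      · have h : LowerTail.embCount E S = 0 := hS
        change LowerTail.embCount E S ≤ _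
        rw [h]
        simp
  · rcases lt_or_eq_of_le hΨ0 with hpos | hzero
    · have hp0' : 0 < (p : ℝ) := by
        rcases lt_or_eq_of_le hp0 with h | h
        · exact h
        · rw [hΨ, LowerTail.blockMean_fullBlock, ← h, zero_pow hne.card_pos.ne', mul_zero] at hpos
          exact absurd hpos (lt_irrefl _)
      refine (LowerTail.upper_bound_embCount hp0' hp1.le hE (by omega) (by omega) hpos hε0
        hmin).trans (Real.exp_le_exp.2 (neg_le_neg ?_))
      gcongr
    · have : Φ = 0 := by linarith
      rw [this, mul_zero, neg_zero, Real.exp_zero]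
      exact LowerTail.prob_le_one hp0 hp1.le _
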